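/- For $n\ge 0$ write a permutation $\sigma$ of $[n]=\{1,\dots,n\}$ in one-line notation $\sigma_1\sigma_2\cdots\sigma_n$. Its descent set is $\mathrm{Des}(\sigma)=\{i\in[n-1] : \sigma_i>\sigma_{i+1}\}$; a peak (resp. valley) of $\sigma$ is a position $1<i<n$ such that $\sigma_i$ is larger (resp. smaller) than both $\sigma_{i-1}$ and $\sigma_{i+1}$; and $\mathrm{Spike}(\sigma)$ is the set of all peaks and valleys of $\sigma$. For a finite set $S$ of positive integers let $D(S,n)$ be the set of permutations of $[n]$ with descent set $S$. For a finite set $I$ of positive integers and $n>\max(I)$ (with $\max(\varnothing)=0$) let $P(I,n)$ be the set of permutations of $[n]$ with peak set $I$, and put $p(I,n)=2^{-n+|I|+1}\,|P(I,n)|$. Call a finite set $I$ of positive integers admissible if $1\notin I$ and $I$ contains no two consecutive integers. For admissible $I$ let $S_I$ be the descent set whose spikes are exactly the elements of $I$, alternating between peaks and valleys with the rightmost one a valley; that is, $j\ge 1$ lies in $S_I$ if and only if the number of $i\in I$ with $i>j$ is odd. For $0\le i\le n$ and a permutation $\sigma$ of $[n]$ with $\{\sigma_1,\dots,\sigma_i\}=\{a_1<\cdots<a_i\}$,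 let $\mathrm{fl}_i(\sigma)$ be the permutation with $\mathrm{fl}_i(\sigma)_j=a_{i-r+1}$ if $j\le i$ and $\sigma_j=a_r$, and $\mathrm{fl}_i(\sigma)_j=\sigma_j$ if $j>i$. We say that $\sigma$ admits an $i$-flip if $i\in\mathrm{Spike}(\sigma)$ and at least one of $\mathrm{Spike}(\mathrm{fl}_i(\sigma))$, $\mathrm{Spike}(\mathrm{fl}_{i-1}(\sigma))$ equals $\mathrm{Spike}(\sigma)\setminus\{i\}$. **Theorem.** Let $I$ be an admissible set and let $m\ge\max(I)$ be an integer. For $0\le k\le m$ let $b_k(I)$ be the number of $\sigma\in D(S_I,2m)$ such that $$\{\sigma_1,\dots,\sigma_m\}\cap[m+1,2m]=[m+1,m+k]$$ and $\sigma$ admits no $i$-flip for any $i$. Then for every integer $n>\max(I)$ $$p(I,n)=\sum_{k=0}^{m} b_k(I)\binom{n-m}{k},$$ where $\binom{x}{k}=x(x-1)\cdots(x-k+1)/k!$. Moreover, the $b_k(I)$ are the only rational coefficients for which this expansion holds for all $n>\max(I)$; in particular, the coefficients of the peak polynomial of $I$ in the binomial basis centered at $m$ are nonnegative. -/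

import Mathlib

/-!
Permutations `σ ∈ 𝔖_n` are elements of `Equiv.Perm (Fin n)`; positions and values are read
1-based, in one-line notation `σ_1 σ_2 ⋯ σ_n`, through `PeakPoly.val`.
-/

namespace PeakPoly

/-- The entry `σ_i ∈ {1, …, n}` of the one-line notation of `σ`, for a position `1 ≤ i ≤ n`
(and `0` for every other `i`; such positions are never used below). -/
def val {n : ℕ} (σ : Equiv.Perm (Fin n)) (i : ℕ) : ℕ :=
  if h : 1 ≤ i ∧ i ≤ n then (σ ⟨i - 1, by omega⟩ : ℕ) + 1 else 0

/-- `Des(σ) = {i ∈ [n-1] : σ_i > σ_{i+1}}`. -/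
def des {n : ℕ} (σ : Equiv.Perm (Fin n)) : Finset ℕ :=
  (Finset.Icc 1 (n - 1)).filter fun i => val σ (i + 1) < val σ i

/-- `Peak(σ)`: the positions `1 < i < n` with `σ_{i-1} < σ_i > σ_{i+1}`. -/
def peak {n : ℕ} (σ : Equiv.Perm (Fin n)) : Finset ℕ :=
  (Finset.Icc 2 (n - 1)).filter fun i => val σ (i - 1) < val σ i ∧ val σ (i + 1) < val σ i

/-- `Valley(σ)`: the positions `1 < i < n` with `σ_{i-1} > σ_i < σ_{i+1}`. -/
def valley {n : ℕ} (σ : Equiv.Perm (Fin n)) : Finset ℕ :=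
  (Finset.Icc 2 (n - 1)).filter fun i => val σ i < val σ (i - 1) ∧ val σ i < val σ (i + 1)

/-- `Spike(σ) = Peak(σ) ∪ Valley(σ)`. -/
def spike {n : ℕ} (σ : Equiv.Perm (Fin n)) : Finset ℕ := peak σ ∪ valley σ

/-- `D(S,n)`: the permutations in `𝔖_n` with descent set `S`. -/
def descentClass (S : Finset ℕ) (n : ℕ) : Finset (Equiv.Perm (Fin n)) :=
  Finset.univ.filter fun σ => des σ = S

/-- `P(I,n)`: the permutations in `𝔖_n` with peak set `I`. -/
def peakClass (I : Finset ℕ) (n : ℕ) : Finset (Equiv.Perm (Fin n)) :=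
  Finset.univ.filter fun σ => peak σ = I

/-- `p(I,n) = 2^{-n+|I|+1} |P(I,n)|`. -/
def peakNumber (I : Finset ℕ) (n : ℕ) : ℚ :=
  (2 : ℚ) ^ (-(n : ℤ) + (I.card : ℤ) + 1) * ((peakClass I n).card : ℚ)

/-- Admissible sets: `1 ∉ I` and no two consecutive elements (elements are positive). -/
def IsAdmissible (I : Finset ℕ) : Prop :=
  ∀ i ∈ I, 2 ≤ i ∧ i + 1 ∉ I

/-- The spikes of a set `S ⊆ [n-1]`: its peaks (`i ∈ S`, `i - 1 ∉ S`) and its valleys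
(`i ∉ S`, `i - 1 ∈ S`), for `1 < i ≤ n - 1`. -/
def setSpike (n : ℕ) (S : Finset ℕ) : Finset ℕ :=
  (Finset.Icc 2 (n - 1)).filter fun i => (i ∈ S ∧ i - 1 ∉ S) ∨ (i ∉ S ∧ i - 1 ∈ S)

/-- `S_I`: the descent set whose spikes are the elements of `I`, alternating between peaks and
valleys, the rightmost one being a valley. Equivalently, a position `j ≥ 1` is a descent exactly
if an odd number of elements of `I` lie to the right of it. See `eq_spikeDescents_iff`. -/
def spikeDescents (I : Finset ℕ) : Finset ℕ :=
  (Finset.Icc 1 (I.sup id)).filter fun j => Odd ((I.filter fun i => j < i).card)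

theorem mem_spikeDescents (I : Finset ℕ) (j : ℕ) :
    j ∈ spikeDescents I ↔ 1 ≤ j ∧ Odd ((I.filter fun i => j < i).card) := by
  simp only [spikeDescents, Finset.mem_filter, Finset.mem_Icc]
  refine ⟨fun h => ⟨h.1.1, h.2⟩, fun h => ⟨⟨h.1, ?_⟩, h.2⟩⟩
  obtain ⟨i, hi⟩ := Finset.card_pos.1 h.2.pos
  rw [Finset.mem_filter] at hi
  exact hi.2.le.trans (Finset.le_sup (f := id) hi.1)

/-- `S_I` is the unique `S ⊆ [n-1]` with `Spike(S) = I` that ends in an ascent (which, for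
nonempty `I`, says that the rightmost spike is not a peak). -/
theorem eq_spikeDescents_iff {n : ℕ} (hn : 2 ≤ n) {I : Finset ℕ}
    (hI : I ⊆ Finset.Icc 2 (n - 1)) (S : Finset ℕ) :
    S = spikeDescents I ↔ S ⊆ Finset.Icc 1 (n - 1) ∧ setSpike n S = I ∧ n - 1 ∉ S := by
  have step : ∀ j, 1 ≤ j → (j ∈ spikeDescents I ↔
      ((j + 1 ∈ spikeDescents I ∧ j + 1 ∉ I) ∨ (j + 1 ∉ spikeDescents I ∧ j + 1 ∈ I))) := by
    intro j hj
    have hc : (I.filter fun i => j < i).card =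
        (I.filter fun i => j + 1 < i).card + if j + 1 ∈ I then 1 else 0 := by
      split_ifs with h
      · rw [show (I.filter fun i => j < i) = insert (j + 1) (I.filter fun i => j + 1 < i) by
          ext x; simp only [Finset.mem_filter, Finset.mem_insert]
          constructor
          · rintro ⟨h1, h2⟩
            rcases Nat.eq_or_lt_of_le (Nat.succ_le_of_lt h2) with h3 | h3
            · exact Or.inl h3.symm
            · exact Or.inr ⟨h1, h3⟩
          · rintro (rfl | ⟨h1, h2⟩)
            · exact ⟨h, by omega⟩
            · exact ⟨h1, by omega⟩]
        rw [Finset.card_insert_of_notMem (by simp)]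
      · rw [add_zero]
        congr 1
        ext x; simp only [Finset.mem_filter]
        refine ⟨fun ⟨h1, h2⟩ => ⟨h1, ?_⟩, fun ⟨h1, h2⟩ => ⟨h1, by omega⟩⟩
        rcases Nat.eq_or_lt_of_le (Nat.succ_le_of_lt h2) with h3 | h3
        · exact absurd (by rw [← h3] at h1; exact h1) h
        · exact h3
    simp only [mem_spikeDescents, hc]
    split_ifs with h <;> simp [h, hj, Nat.odd_add_one]
  have top : ∀ j, n - 1 ≤ j → j ∉ spikeDescents I := by
    intro j hj h
    rw [mem_spikeDescents] at h
    obtain ⟨i, hi⟩ := Finset.card_pos.1 h.2.pos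
    rw [Finset.mem_filter] at hi
    have := Finset.mem_Icc.1 (hI hi.1)
    omega
  constructor
  · rintro rfl
    refine ⟨fun j hj => ?_, ?_, top _ le_rfl⟩
    · have h1 := ((mem_spikeDescents I j).1 hj).1
      have h2 : ¬ n - 1 ≤ j := fun h => top j h hj
      exact Finset.mem_Icc.2 ⟨h1, by omega⟩
    · ext i
      simp only [setSpike, Finset.mem_filter]
      constructor
      · rintro ⟨h1, h2⟩
        obtain ⟨h3, h4⟩ := Finset.mem_Icc.1 h1
        have := step (i - 1) (by omega)
        rw [Nat.sub_add_cancel (by omega)] at this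
        tauto
      · intro h
        obtain ⟨h3, h4⟩ := Finset.mem_Icc.1 (hI h)
        have := step (i - 1) (by omega)
        rw [Nat.sub_add_cancel (by omega)] at this
        exact ⟨hI h, by tauto⟩
  · rintro ⟨hS, hsp, hlast⟩
    have key : ∀ d j, 1 ≤ j → j + d = n - 1 → (j ∈ S ↔ j ∈ spikeDescents I) := by
      intro d
      induction d with
      | zero =>
        intro j _ hj
        have : j = n - 1 := by omega
        subst this
        exact iff_of_false hlast (top _ le_rfl)
      | succ d ih =>
        intro j h1 hj
        have h2 := ih (j + 1) (by omega) (by omega)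
        have h3 := step j h1
        have h4 : j + 1 ∈ I ↔ ((j + 1 ∈ S ∧ j ∉ S) ∨ (j + 1 ∉ S ∧ j ∈ S)) := by
          rw [← hsp]
          simp only [setSpike, Finset.mem_filter, Finset.mem_Icc, Nat.add_sub_cancel]
          exact ⟨fun h => h.2, fun h => ⟨⟨by omega, by omega⟩, h⟩⟩
        tauto
    ext j
    by_cases hj : 1 ≤ j ∧ j ≤ n - 1
    · exact key (n - 1 - j) j hj.1 (by omega)
    · refine iff_of_false (fun h => hj (Finset.mem_Icc.1 (hS h))) (fun h => ?_)
      have h1 := ((mem_spikeDescents I j).1 h).1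
      exact top j (by omega) h

/-- `{σ_1, …, σ_i}`, as a set of values in `[n]`. -/
def init {n : ℕ} (i : ℕ) (σ : Equiv.Perm (Fin n)) : Finset ℕ :=
  (Finset.Icc 1 i).image (val σ)

/-- The permutation of a finite linear order that reverses the set
`A = {a_1 < ⋯ < a_r}`, that is `a_k ↦ a_{r-k+1}`, and fixes every element outside `A`. -/
def reverseOn {n : ℕ} (A : Finset (Fin n)) : Equiv.Perm (Fin n) :=
  Equiv.Perm.ofSubtype
    ((A.orderIsoOfFin rfl).symm.toEquiv.trans
      (Fin.revPerm.trans (A.orderIsoOfFin rfl).toEquiv) : Equiv.Perm {x // x ∈ A})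

/-- `fl_i(σ)`: if `{σ_1, …, σ_i} = {a_1 < ⋯ < a_i}`, the entry `σ_j = a_k` is replaced by
`a_{i-k+1}` for `j ≤ i`, and the entries at positions `j > i` stay. (The first `i` positions are
the `j : Fin n` with `j < i`, and an entry lies in the set of the first `i` entries exactly if its
position is one of these.) -/
def fl {n : ℕ} (i : ℕ) (σ : Equiv.Perm (Fin n)) : Equiv.Perm (Fin n) :=
  reverseOn ((Finset.univ.filter fun j : Fin n => (j : ℕ) < i).image σ) * σ

/-- `σ` admits an `i⁺`-flip. -/
def AdmitsFlipPlus {n : ℕ} (σ : Equiv.Perm (Fin n)) (i : ℕ) : Prop :=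
  i ∈ spike σ ∧ spike (fl i σ) = spike σ \ {i}

/-- `σ` admits an `i⁻`-flip. -/
def AdmitsFlipMinus {n : ℕ} (σ : Equiv.Perm (Fin n)) (i : ℕ) : Prop :=
  i ∈ spike σ ∧ spike (fl (i - 1) σ) = spike σ \ {i}

/-- `σ` admits an `i`-flip. -/
def AdmitsFlip {n : ℕ} (σ : Equiv.Perm (Fin n)) (i : ℕ) : Prop :=
  AdmitsFlipPlus σ i ∨ AdmitsFlipMinus σ i

open Classical in
/-- `b_k(I)`, relative to `m`: the number of `σ ∈ D(S_I, 2m)` such that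
`{σ_1, …, σ_m} ∩ [m+1, 2m] = [m+1, m+k]` and `σ` admits no `i`-flip. -/
noncomputable def peakCoeff (I : Finset ℕ) (m k : ℕ) : ℕ :=
  ((descentClass (spikeDescents I) (2 * m)).filter fun σ =>
    init m σ ∩ Finset.Icc (m + 1) (2 * m) = Finset.Icc (m + 1) (m + k) ∧
      ∀ i, ¬ AdmitsFlip σ i).card

end PeakPoly

/-!
A permutation is encoded by the word `x_j = #{i < j : σ_i < σ_j} - #{i < j : σ_i > σ_j}`. The code
has the same descents as `σ`, and `fl_i` negates its first `i` letters, so that the codes are closed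
under sign changes and `σ` admits no flip exactly if every spike is a peak of `|x|`. Comparing the
codes with the words of signed permutations, another family closed under sign changes, gives
`p(I,n)` as the number of flip-free elements of `D(S_I,n)`. These are then counted by the set of
their first `m` values.
-/

namespace PeakPoly

open Finset

/-! Say that a letter dominates a neighbour if its absolute value is larger. If adjacent letters
differ in absolute value, the sign of the dominant one alone decides whether they form a descent. A
letter dominating both neighbours, a peak of `|x|`, is a spike whatever its sign; every other letter
controls at most one pair. So in a family closed under sign changes, the number `g(J)` of words with
descent set `S` and absolute peak set `J` is the same for all `S` with `J ⊆ Spike(S)`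
(`IsSignClosed.card_eq`). Summing over `J`, respectively over `S`, gives `#{Des = S_I} = ∑_{J ⊆ I}
g(J)` and, for admissible `J`, `#{absPeaks = J} = 2^(n-1-|J|) g(J)`.

The first relation is triangular, so descent counts determine `g`. Every descent class has `2^n`
times as many signed words as codes, hence the same factor relates the two functions `g`. The
absolute peaks of a signed word are the peaks of the underlying permutation, so the second relation
identifies `p(I,n)` with `g(I)` for codes (`peakNumber_eq_flipFreeCount`). By `admitsFlip_iff` this
counts flip-free permutations.

For `n = m + N`, members of `D(S_I,n)` increase after position `m`, so they are given by the set `A`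
of their first `m` values and the pattern of these. Flip-freeness depends only on the pattern and on
how many elements of `A` lie below every missing value, a number determined by `A ∩ [m]`. Hence the
count with `A \ [m]` prescribed depends only on the size `k` of that set, not on `N`; `N = m`
identifies it with `b_k`, and there are `binom(N,k)` such sets. The range `max(I) < n < m` follows
by polynomiality. -/

/-! ### Integer words and the switching of signs. -/

/-- The descent set of the word `x_1 ⋯ x_n` of integers. -/
def descents (n : ℕ) (x : ℕ → ℤ) : Finset ℕ :=
  (Icc 1 (n - 1)).filter fun i => x (i + 1) < x i

/-- The peak set of the word `|x_1| ⋯ |x_n|`. -/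
def absPeaks (n : ℕ) (x : ℕ → ℤ) : Finset ℕ :=
  (Icc 2 (n - 1)).filter fun i => |x (i - 1)| < |x i| ∧ |x (i + 1)| < |x i|

/-- Adjacent letters of `x_1 ⋯ x_n` have different absolute values. -/
def AbsSeparated (n : ℕ) (x : ℕ → ℤ) : Prop :=
  ∀ i, 1 ≤ i → i < n → |x i| ≠ |x (i + 1)|

theorem mem_descents {n : ℕ} {x : ℕ → ℤ} {i : ℕ} :
    i ∈ descents n x ↔ (1 ≤ i ∧ i < n) ∧ x (i + 1) < x i := by
  simp only [descents, mem_filter, mem_Icc]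
  exact and_congr_left' (by omega)

theorem mem_absPeaks {n : ℕ} {x : ℕ → ℤ} {i : ℕ} :
    i ∈ absPeaks n x ↔ (2 ≤ i ∧ i < n) ∧ |x (i - 1)| < |x i| ∧ |x (i + 1)| < |x i| := by
  simp only [absPeaks, mem_filter, mem_Icc]
  exact and_congr_left' (by omega)

theorem mem_setSpike {n : ℕ} {S : Finset ℕ} {i : ℕ} :
    i ∈ setSpike n S ↔ (2 ≤ i ∧ i < n) ∧ ¬ (i ∈ S ↔ i - 1 ∈ S) := by
  simp only [setSpike, mem_filter, mem_Icc]
  refine and_congr (by omega) (by tauto)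

theorem descents_subset (n : ℕ) (x : ℕ → ℤ) : descents n x ⊆ Icc 1 (n - 1) :=
  filter_subset _ _

theorem descents_congr {n : ℕ} {x y : ℕ → ℤ} (h : ∀ j, 1 ≤ j → j ≤ n → x j = y j) :
    descents n x = descents n y := by
  ext i
  rw [mem_descents, mem_descents]
  refine and_congr_right fun hi => ?_
  rw [h i hi.1 (by omega), h (i + 1) (by omega) (by omega)]

theorem absPeaks_congr {n : ℕ} {x y : ℕ → ℤ} (h : ∀ j, 1 ≤ j → j ≤ n → |x j| = |y j|) :
    absPeaks n x = absPeaks n y := by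
  ext i
  rw [mem_absPeaks, mem_absPeaks]
  refine and_congr_right fun hi => ?_
  rw [h i (by omega) (by omega), h (i + 1) (by omega) (by omega), h (i - 1) (by omega) (by omega)]

theorem lt_iff_pos_of_abs_lt {a b : ℤ} (h : |b| < |a|) : b < a ↔ 0 < a := by
  rcases abs_cases a with ha | ha <;> rcases abs_cases b with hb | hb <;> omega

theorem lt_iff_neg_of_abs_lt {a b : ℤ} (h : |b| < |a|) : a < b ↔ a < 0 := by
  rcases abs_cases a with ha | ha <;> rcases abs_cases b with hb | hb <;> omega

/-- A letter dominating both neighbours is nonzero, and its sign makes exactly one of the two pairs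
a descent. -/
theorem absPeaks_subset_setSpike {n : ℕ} {x : ℕ → ℤ} :
    absPeaks n x ⊆ setSpike n (descents n x) := by
  intro i hi
  obtain ⟨hi, h1, h2⟩ := mem_absPeaks.1 hi
  obtain ⟨j, rfl⟩ : ∃ j, i = j + 1 := ⟨i - 1, by omega⟩
  rw [Nat.add_sub_cancel] at h1
  rw [mem_setSpike, mem_descents, mem_descents, Nat.add_sub_cancel, lt_iff_pos_of_abs_lt h2,
    lt_iff_neg_of_abs_lt h1]
  have : x (j + 1) ≠ 0 := fun h => by
    rw [h, abs_zero] at h1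
    exact absurd h1 (abs_nonneg _).not_gt
  omega

open Classical in
/-- The signs that turn a word with descent set `S` and absolute values `y_1, …, y_n` into one with
descent set `S'`: whether two adjacent letters form a descent depends only on the sign of the one
with the larger absolute value. -/
noncomputable def switchSign (n : ℕ) (S S' : Finset ℕ) (y : ℕ → ℤ) (j : ℕ) : ℤ :=
  if j < n ∧ y (j + 1) < y j then (if j ∈ S ↔ j ∈ S' then 1 else -1)
  else if 1 < j ∧ y (j - 1) < y j then (if j - 1 ∈ S ↔ j - 1 ∈ S' then 1 else -1)
  -- A letter that dominates no neighbour affects no descent and keeps its sign.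
  else 1

theorem switchSign_eq (n : ℕ) (S S' : Finset ℕ) (y : ℕ → ℤ) (j : ℕ) :
    switchSign n S S' y j = 1 ∨ switchSign n S S' y j = -1 := by
  unfold switchSign
  split_ifs <;> simp

theorem abs_sign_mul {d : ℤ} (h : d = 1 ∨ d = -1) (a : ℤ) : |d * a| = |a| := by
  rcases h with rfl | rfl <;> simp

/-- The dominant letter of a pair must change sign exactly if `S` and `S'` disagree there. Only an
absolute peak governs two pairs, and `hp` makes its two requirements compatible. -/
theorem descents_switchSign_mul {n : ℕ} {S S' : Finset ℕ} {x : ℕ → ℤ} (hx : AbsSeparated n x)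
    (hS : descents n x = S) (hS' : S' ⊆ Icc 1 (n - 1)) (hp : absPeaks n x ⊆ setSpike n S') :
    descents n (fun j => switchSign n S S' (fun i => |x i|) j * x j) = S' := by
  have hp' : absPeaks n x ⊆ setSpike n S := hS ▸ absPeaks_subset_setSpike
  ext e
  by_cases he : 1 ≤ e ∧ e < n
  swap
  · refine iff_of_false (fun h => he (mem_descents.1 h).1) fun h => he ?_
    have := mem_Icc.1 (hS' h)
    omega
  have hmem : e ∈ S ↔ x (e + 1) < x e := by
    rw [← hS, mem_descents]; exact and_iff_right he
  rw [mem_descents, and_iff_right he]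
  have habs := fun j => abs_sign_mul (switchSign_eq n S S' (fun i => |x i|) j) (x j)
  rcases lt_or_gt_of_ne (hx e he.1 he.2) with hlt | hlt
  · rw [lt_iff_neg_of_abs_lt (by rw [habs, habs]; exact hlt)]
    rw [lt_iff_neg_of_abs_lt hlt] at hmem
    have h0 : x (e + 1) ≠ 0 := fun h => by
      rw [h, abs_zero] at hlt
      exact absurd hlt (abs_nonneg _).not_gt
    have hsw : switchSign n S S' (fun i => |x i|) (e + 1) =
        if e ∈ S ↔ e ∈ S' then 1 else -1 := by
      unfold switchSign
      by_cases hc : e + 1 < n ∧ |x (e + 1 + 1)| < |x (e + 1)|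
      -- Both `S` and `S'` have a spike at `e + 1`, so they agree at `e` exactly if they agree at `e
      -- + 1`: both pairs demand the same sign.
      · have hpk : e + 1 ∈ absPeaks n x := mem_absPeaks.2 ⟨by omega, hlt, hc.2⟩
        have h1 := (mem_setSpike.1 (hp hpk)).2
        have h2 := (mem_setSpike.1 (hp' hpk)).2
        rw [Nat.add_sub_cancel] at h1 h2
        rw [if_pos hc]
        congr 1
        rw [eq_iff_iff]
        tauto
      · rw [if_neg hc, if_pos ⟨by omega, by simpa using hlt⟩, Nat.add_sub_cancel]
    rw [hsw]
    split_ifs with hc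
    · rw [one_mul, ← hmem, hc]
    · rw [neg_one_mul]
      have hc' : e ∈ S' ↔ ¬ e ∈ S := by tauto
      rw [hc', hmem]
      omega
  · rw [lt_iff_pos_of_abs_lt (by rw [habs, habs]; exact hlt)]
    rw [lt_iff_pos_of_abs_lt hlt] at hmem
    have h0 : x e ≠ 0 := fun h => by
      rw [h, abs_zero] at hlt
      exact absurd hlt (abs_nonneg _).not_gt
    have hsw : switchSign n S S' (fun i => |x i|) e =
        if e ∈ S ↔ e ∈ S' then 1 else -1 := by
      unfold switchSign
      rw [if_pos ⟨he.2, hlt⟩]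
    rw [hsw]
    split_ifs with hc
    · rw [one_mul, ← hmem, hc]
    · rw [neg_one_mul]
      have hc' : e ∈ S' ↔ ¬ e ∈ S := by tauto
      rw [hc', hmem]
      omega

/-! ### Counting in families closed under sign changes. -/

/-- A family of integer words of length `n`, without repetitions, that is closed under changes of
the signs of the letters, and in which adjacent letters have different absolute values. -/
structure IsSignClosed {Ω : Type*} (n : ℕ) (x : Ω → ℕ → ℤ) : Prop where
  ext : ∀ ω ω', (∀ j, 1 ≤ j → j ≤ n → x ω j = x ω' j) → ω = ω'
  separated : ∀ ω, AbsSeparated n (x ω)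
  closed : ∀ ω (d : ℕ → ℤ), (∀ j, d j = 1 ∨ d j = -1) →
    ∃ ω', ∀ j, 1 ≤ j → j ≤ n → x ω' j = d j * x ω j

namespace IsSignClosed

variable {Ω : Type*} [Fintype Ω] {n : ℕ} {x : Ω → ℕ → ℤ}

/-- The switching signs depend only on absolute values, which switching preserves; two words with
the same image thus received the same signs and coincide. -/
theorem card_le (h : IsSignClosed n x) {S S' J : Finset ℕ} (hS' : S' ⊆ Icc 1 (n - 1))
    (hJ' : J ⊆ setSpike n S') :
    #{ω | descents n (x ω) = S ∧ absPeaks n (x ω) = J} ≤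
      #{ω | descents n (x ω) = S' ∧ absPeaks n (x ω) = J} := by
  choose f hf using fun ω => h.closed ω (switchSign n S S' fun i => |x ω i|)
    (switchSign_eq n S S' _)
  have habs : ∀ ω j, 1 ≤ j → j ≤ n → |x (f ω) j| = |x ω j| := fun ω j h1 h2 => by
    rw [hf ω j h1 h2, abs_sign_mul (switchSign_eq n S S' _ j)]
  refine card_le_card_of_injOn f (fun ω hω => ?_) fun ω _ ω' _ he => ?_
  · simp only [coe_filter, mem_univ, true_and, Set.mem_ofPred_eq] at hω ⊢
    refine ⟨?_, (absPeaks_congr (habs ω)).trans hω.2⟩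
    rw [descents_congr (hf ω)]
    exact descents_switchSign_mul (h.separated ω) hω.1 hS' (hω.2 ▸ hJ')
  · refine h.ext ω ω' fun j h1 h2 => ?_
    have hy : ∀ i, 1 ≤ i → i ≤ n → |x ω i| = |x ω' i| := fun i h1 h2 => by
      rw [← habs ω i h1 h2, ← habs ω' i h1 h2, he]
    have hsw : switchSign n S S' (fun i => |x ω i|) j = switchSign n S S' (fun i => |x ω' i|) j := by
      have e1 : (j < n ∧ |x ω (j + 1)| < |x ω j|) ↔ (j < n ∧ |x ω' (j + 1)| < |x ω' j|) :=
        and_congr_right fun hj => by rw [hy j h1 h2, hy (j + 1) (by omega) (by omega)]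
      have e2 : (1 < j ∧ |x ω (j - 1)| < |x ω j|) ↔ (1 < j ∧ |x ω' (j - 1)| < |x ω' j|) :=
        and_congr_right fun hj => by rw [hy j h1 h2, hy (j - 1) (by omega) (by omega)]
      simp only [switchSign, e1, e2]
    have h3 := hf ω j h1 h2
    rw [he, hf ω' j h1 h2, hsw] at h3
    have h4 := switchSign_eq n S S' (fun i => |x ω' i|) j
    rcases h4 with h4 | h4 <;> rw [h4] at h3 <;> omega

theorem card_eq (h : IsSignClosed n x) {S S' J : Finset ℕ} (hS : S ⊆ Icc 1 (n - 1))
    (hJ : J ⊆ setSpike n S) (hS' : S' ⊆ Icc 1 (n - 1)) (hJ' : J ⊆ setSpike n S') :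
    #{ω | descents n (x ω) = S ∧ absPeaks n (x ω) = J} =
      #{ω | descents n (x ω) = S' ∧ absPeaks n (x ω) = J} :=
  (h.card_le hS' hJ').antisymm (h.card_le hS hJ)

end IsSignClosed

theorem spikeDescents_spec {n : ℕ} {I : Finset ℕ} (hI : I ⊆ Icc 2 (n - 1)) :
    spikeDescents I ⊆ Icc 1 (n - 1) ∧ setSpike n (spikeDescents I) = I := by
  rcases le_or_gt 2 n with hn | hn
  · exact ⟨((eq_spikeDescents_iff hn hI _).1 rfl).1, ((eq_spikeDescents_iff hn hI _).1 rfl).2.1⟩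
  · have h0 : I = ∅ := subset_empty.1 (hI.trans (by rw [Icc_eq_empty (by omega)]))
    subst h0
    refine ⟨by simp [spikeDescents], ?_⟩
    rw [setSpike, Icc_eq_empty (by omega), filter_empty]

theorem subset_Icc_of_isAdmissible {I : Finset ℕ} (hI : IsAdmissible I) {n : ℕ}
    (hn : I.sup id < n) : I ⊆ Icc 2 (n - 1) := fun i hi => by
  have h1 : i ≤ I.sup id := le_sup (f := id) hi
  have h2 := (hI i hi).1
  exact mem_Icc.2 ⟨h2, by omega⟩

/-- The number of sets of descents with spikes at the elements of an admissible set `J`. -/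
theorem card_filter_subset_setSpike {n : ℕ} {J : Finset ℕ} (hJ : IsAdmissible J)
    (hJn : J ⊆ Icc 2 (n - 1)) :
    #{S ∈ (Icc 1 (n - 1)).powerset | J ⊆ setSpike n S} = 2 ^ (n - 1 - #J) := by
  have hinj : Set.InjOn (fun j => j - 1) (J : Set ℕ) := fun a ha b hb hab => by
    have h1 := (hJ a ha).1
    have h2 := (hJ b hb).1
    simp only at hab
    omega
  have hmem : ∀ e, e ∈ J.image (fun j => j - 1) ↔ e + 1 ∈ J := fun e => by
    simp only [mem_image]
    constructor
    · rintro ⟨a, ha, rfl⟩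
      rwa [Nat.sub_add_cancel (by have := (hJ a ha).1; omega)]
    · exact fun h => ⟨e + 1, h, rfl⟩
  have hsub : J.image (fun j => j - 1) ⊆ Icc 1 (n - 1) := fun e he => by
    have := mem_Icc.1 (hJn ((hmem e).1 he))
    exact mem_Icc.2 (by omega)
  have hcard : #(Icc 1 (n - 1) \ J.image fun j => j - 1) = n - 1 - #J := by
    rw [card_sdiff_of_subset hsub, card_image_of_injOn hinj, Nat.card_Icc, Nat.add_sub_cancel]
  rw [← hcard, ← card_powerset]
  -- For `j ∈ J`, a spike at `j` means that `j - 1 ∈ S` exactly if `j ∉ S`. As `J` has no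
  -- consecutive elements, `j` is not itself one of these forced positions, so the remaining
  -- positions are free.
  refine card_nbij' (fun S => S \ J.image fun j => j - 1)
    (fun T => T ∪ {e ∈ J.image fun j => j - 1 | e + 1 ∉ T}) ?_ ?_ ?_ ?_
  · intro S hS
    simp only [coe_filter, mem_powerset, Set.mem_ofPred_eq] at hS
    exact mem_coe.2 (mem_powerset.2 (sdiff_subset_sdiff hS.1 (Subset.refl _)))
  · intro T hT
    have hT' := mem_powerset.1 (mem_coe.1 hT)
    simp only [coe_filter, mem_powerset, Set.mem_ofPred_eq]
    refine ⟨union_subset (hT'.trans sdiff_subset) ((filter_subset _ _).trans hsub), fun j hj => ?_⟩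
    have h2 := (hJ j hj)
    obtain ⟨e, rfl⟩ : ∃ e, j = e + 1 := ⟨j - 1, by omega⟩
    have h3 := mem_Icc.1 (hJn hj)
    have h4 : e ∉ T := fun h => (mem_sdiff.1 (hT' h)).2 ((hmem e).2 hj)
    rw [mem_setSpike]
    refine ⟨by omega, ?_⟩
    simp only [mem_union, mem_filter, hmem, Nat.add_sub_cancel, h2.2, hj, h4]
    tauto
  · intro S hS
    simp only [coe_filter, mem_powerset, Set.mem_ofPred_eq] at hS
    ext e
    simp only [mem_union, mem_filter, mem_sdiff, hmem]
    by_cases he : e + 1 ∈ J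
    · have h1 := (mem_setSpike.1 (hS.2 he)).2
      have h2 := (hJ _ he).2
      rw [Nat.add_sub_cancel] at h1
      tauto
    · tauto
  · intro T hT
    have hT' := mem_powerset.1 (mem_coe.1 hT)
    ext e
    simp only [mem_union, mem_filter, mem_sdiff, hmem]
    have h4 : e ∈ T → e + 1 ∉ J := fun h h' => (mem_sdiff.1 (hT' h)).2 ((hmem e).2 h')
    tauto

namespace IsSignClosed

variable {Ω : Type*} [Fintype Ω] {n : ℕ} {x : Ω → ℕ → ℤ}

/-- In each fibre over an absolute peak set `J`, `card_eq` replaces the descent set of `I` by that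
of `J`; the summands no longer depend on `I`, which allows triangular inversion. -/
theorem card_descents_eq_sum (h : IsSignClosed n x) {I : Finset ℕ} (hI : I ⊆ Icc 2 (n - 1)) :
    #{ω | descents n (x ω) = spikeDescents I} =
      ∑ J ∈ I.powerset, #{ω | descents n (x ω) = spikeDescents J ∧ absPeaks n (x ω) = J} := by
  have hs := spikeDescents_spec hI
  rw [card_eq_sum_card_fiberwise (f := fun ω => absPeaks n (x ω)) (t := I.powerset)]
  · refine sum_congr rfl fun J hJ => ?_
    have hJI := mem_powerset.1 hJ
    have hs' := spikeDescents_spec (hJI.trans hI)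
    rw [filter_filter]
    exact h.card_eq hs.1 (by rwa [hs.2]) hs'.1 hs'.2.ge
  · intro ω hω
    simp only [coe_filter, mem_univ, true_and, Set.mem_ofPred_eq] at hω
    rw [mem_coe, mem_powerset, ← hs.2, ← hω]
    exact absPeaks_subset_setSpike

/-- All descent sets with spikes at `J` contribute equally, and `card_filter_subset_setSpike` counts
them. -/
theorem card_absPeaks_eq (h : IsSignClosed n x) {J : Finset ℕ} (hJ : IsAdmissible J)
    (hJn : J ⊆ Icc 2 (n - 1)) :
    #{ω | absPeaks n (x ω) = J} =
      2 ^ (n - 1 - #J) *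
        #{ω | descents n (x ω) = spikeDescents J ∧ absPeaks n (x ω) = J} := by
  have hs := spikeDescents_spec hJn
  rw [← card_filter_subset_setSpike hJ hJn, card_eq_sum_card_fiberwise
    (f := fun ω => descents n (x ω)) (t := {S ∈ (Icc 1 (n - 1)).powerset | J ⊆ setSpike n S})]
  · rw [← smul_eq_mul, ← sum_const]
    refine sum_congr rfl fun S hS => ?_
    obtain ⟨h1, h2⟩ := mem_filter.1 hS
    rw [filter_filter, ← h.card_eq (mem_powerset.1 h1) h2 hs.1 hs.2.ge]
    congr 1
    ext ω
    simp only [mem_filter, and_comm]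
  · intro ω hω
    simp only [coe_filter, mem_univ, true_and, Set.mem_ofPred_eq, mem_powerset] at hω ⊢
    exact ⟨descents_subset _ _, hω ▸ absPeaks_subset_setSpike⟩

end IsSignClosed

/-! ### The code of a permutation. -/

section Val

variable {n : ℕ}

theorem val_eq (σ : Equiv.Perm (Fin n)) {i : ℕ} (h1 : 1 ≤ i) (h2 : i ≤ n) :
    val σ i = (σ ⟨i - 1, by omega⟩ : ℕ) + 1 := dif_pos ⟨h1, h2⟩

theorem val_fin (σ : Equiv.Perm (Fin n)) (p : Fin n) : val σ (p + 1) = (σ p : ℕ) + 1 :=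
  val_eq σ (by omega) (by omega)

theorem val_inj (σ : Equiv.Perm (Fin n)) {i j : ℕ} (hi : 1 ≤ i) (hi' : i ≤ n) (hj : 1 ≤ j)
    (hj' : j ≤ n) (h : val σ i = val σ j) : i = j := by
  rw [val_eq σ hi hi', val_eq σ hj hj', Nat.add_right_cancel_iff, Fin.val_inj,
    σ.injective.eq_iff, Fin.mk.injEq] at h
  omega

/-- `#{i < j : σ_i < σ_j} - #{i < j : σ_i > σ_j}`. -/
def code (σ : Equiv.Perm (Fin n)) (j : ℕ) : ℤ :=
  ∑ i ∈ Ico 1 j, if val σ i < val σ j then 1 else -1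

theorem code_eq_card (σ : Equiv.Perm (Fin n)) {j : ℕ} (hj : 1 ≤ j) :
    code σ j = 2 * #{i ∈ Ico 1 j | val σ i < val σ j} - (j - 1 : ℤ) := by
  have h : (j - 1 : ℤ) = ∑ i ∈ Ico 1 j, (1 : ℤ) := by simp; omega
  rw [code, h, card_filter, Nat.cast_sum, mul_sum, ← sum_sub_distrib]
  refine sum_congr rfl fun i _ => ?_
  split_ifs <;> simp

/-- Enlarging the entry compared with the first `j - 1` entries cannot decrease the sum; the extra
term at `i = j` makes the inequality strict. -/
theorem code_succ_lt_iff (σ : Equiv.Perm (Fin n)) {j : ℕ} (hj : 1 ≤ j) (hj' : j < n) :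
    code σ (j + 1) < code σ j ↔ val σ (j + 1) < val σ j := by
  have hne : val σ (j + 1) ≠ val σ j := fun h => by
    have := val_inj σ (by omega) (by omega) hj (by omega) h
    omega
  rw [code, sum_Ico_succ_top hj]
  rcases lt_or_gt_of_ne hne with h | h
  · refine iff_of_true ?_ h
    rw [if_neg (by omega)]
    have : ∑ i ∈ Ico 1 j, (if val σ i < val σ (j + 1) then (1 : ℤ) else -1) ≤ code σ j :=
      sum_le_sum fun i _ => by split_ifs <;> omega
    omega
  · refine iff_of_false (fun h' => ?_) (by omega)
    rw [if_pos h] at h'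
    have : code σ j ≤ ∑ i ∈ Ico 1 j, (if val σ i < val σ (j + 1) then (1 : ℤ) else -1) :=
      sum_le_sum fun i _ => by split_ifs <;> omega
    omega

theorem des_eq_descents_code (σ : Equiv.Perm (Fin n)) : des σ = descents n (code σ) := by
  ext i
  simp only [des, mem_filter, mem_Icc, mem_descents]
  constructor
  · rintro ⟨h1, h2⟩
    exact ⟨by omega, (code_succ_lt_iff σ (by omega) (by omega)).2 h2⟩
  · rintro ⟨h1, h2⟩
    exact ⟨by omega, (code_succ_lt_iff σ (by omega) (by omega)).1 h2⟩

theorem des_eq_descents_val (σ : Equiv.Perm (Fin n)) :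
    des σ = descents n (fun i => (val σ i : ℤ)) := by
  simp only [des, descents, Nat.cast_lt]

theorem peak_eq_absPeaks_val (σ : Equiv.Perm (Fin n)) :
    peak σ = absPeaks n (fun i => (val σ i : ℤ)) := by
  simp only [peak, absPeaks, Nat.abs_cast, Nat.cast_lt]

theorem spike_eq_setSpike (σ : Equiv.Perm (Fin n)) : spike σ = setSpike n (des σ) := by
  ext i
  simp only [spike, peak, valley, mem_union, mem_filter, mem_Icc, mem_setSpike, des]
  by_cases hi : 2 ≤ i ∧ i ≤ n - 1
  · have h1 : val σ (i + 1) ≠ val σ i := fun h => by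
      have := val_inj σ (by omega) (by omega) (by omega) (by omega) h
      omega
    have h2 : val σ (i - 1) ≠ val σ i := fun h => by
      have := val_inj σ (by omega) (by omega) (by omega) (by omega) h
      omega
    rw [Nat.sub_add_cancel (by omega)]
    omega
  · exact iff_of_false (by tauto) (by omega)

/-- The letter in position `j` has the parity of `j - 1`. -/
theorem absSeparated_code (σ : Equiv.Perm (Fin n)) : AbsSeparated n (code σ) := by
  intro i hi _ h
  rw [code_eq_card σ hi, code_eq_card σ (by omega : 1 ≤ i + 1)] at h
  rcases abs_eq_abs.1 h with h | h <;> push_cast at h <;> omega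

/-- The letter in position `j + 1` gives the number of earlier entries that are smaller. These form
an initial segment in the relative order of the first `j` entries, so their number determines them.
-/
theorem val_lt_iff_of_code_eq {σ τ : Equiv.Perm (Fin n)}
    (h : ∀ j, 1 ≤ j → j ≤ n → code σ j = code τ j) :
    ∀ j ≤ n, ∀ a b, 1 ≤ a → a ≤ j → 1 ≤ b → b ≤ j → (val σ a < val σ b ↔ val τ a < val τ b) := by
  intro j
  induction j with
  | zero => intro _ a b; omega
  | succ j ih =>
    intro hj
    have ih := ih (by omega)
    set L : Equiv.Perm (Fin n) → Finset ℕ := fun ρ => {i ∈ Ico 1 (j + 1) | val ρ i < val ρ (j + 1)}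
      with hL
    have hcard : #(L σ) = #(L τ) := by
      have := h (j + 1) (by omega) hj
      rw [code_eq_card σ (by omega), code_eq_card τ (by omega)] at this
      simp only [hL]
      omega
    have hset : L σ = L τ := by
      by_contra hne
      have h1 : ¬ L σ ⊆ L τ := fun hs => hne (eq_of_subset_of_card_le hs hcard.ge)
      have h2 : ¬ L τ ⊆ L σ := fun hs => hne (eq_of_subset_of_card_le hs hcard.le).symm
      obtain ⟨a, ha, ha'⟩ := not_subset.1 h1
      obtain ⟨b, hb, hb'⟩ := not_subset.1 h2
      simp only [hL, mem_filter, mem_Ico] at ha ha' hb hb'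
      have := ih a b (by omega) (by omega) (by omega) (by omega)
      omega
    have hlast : ∀ a, 1 ≤ a → a ≤ j → (val σ a < val σ (j + 1) ↔ val τ a < val τ (j + 1)) := by
      intro a h1 h2
      have := Finset.ext_iff.1 hset a
      simp only [hL, mem_filter, mem_Ico] at this
      have h3 : 1 ≤ a ∧ a < j + 1 := by omega
      tauto
    intro a b ha ha' hb hb'
    rcases Nat.lt_or_ge j a with h1 | h1 <;> rcases Nat.lt_or_ge j b with h2 | h2
    · have h1 : a = b := by omega
      subst h1
      simp
    · have h3 : a = j + 1 := by omega
      subst h3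
      have h4 := hlast b hb h2
      have h5 : val σ b ≠ val σ (j + 1) := fun h => by
        have := val_inj σ hb (by omega) (by omega) (by omega) h; omega
      have h6 : val τ b ≠ val τ (j + 1) := fun h => by
        have := val_inj τ hb (by omega) (by omega) (by omega) h; omega
      omega
    · have h3 : b = j + 1 := by omega
      subst h3
      exact hlast a ha h1
    · exact ih a b ha h1 hb h2

theorem eq_of_lt_iff {σ τ : Equiv.Perm (Fin n)} (h : ∀ a b, σ a < σ b → τ a < τ b) : σ = τ := by
  have hm : StrictMono (τ * σ⁻¹ : Equiv.Perm (Fin n)) := fun a b hab => by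
    simp only [Equiv.Perm.mul_apply]
    exact h _ _ (by simpa using hab)
  have h1 := (hm.range_inj strictMono_id).1 (by simp)
  ext a
  have := congrFun h1 (σ a)
  simp at this
  rw [this]

theorem eq_of_code_eq {σ τ : Equiv.Perm (Fin n)}
    (h : ∀ j, 1 ≤ j → j ≤ n → code σ j = code τ j) : σ = τ := by
  refine eq_of_lt_iff fun a b hab => ?_
  have := val_lt_iff_of_code_eq h n le_rfl (a + 1) (b + 1) (by omega) (by omega) (by omega)
    (by omega)
  simp only [val_fin] at this
  omega

end Val

/-! ### Flips as sign changes of the code. -/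

section Flip

variable {n : ℕ}

theorem reverseOn_of_notMem {A : Finset (Fin n)} {a : Fin n} (h : a ∉ A) : reverseOn A a = a :=
  Equiv.Perm.ofSubtype_apply_of_not_mem _ h

theorem reverseOn_mem {A : Finset (Fin n)} {a : Fin n} (h : a ∈ A) : reverseOn A a ∈ A := by
  rw [reverseOn, Equiv.Perm.ofSubtype_apply_of_mem _ h]
  exact Subtype.prop _

theorem reverseOn_lt_iff {A : Finset (Fin n)} {a b : Fin n} (ha : a ∈ A) (hb : b ∈ A) :
    reverseOn A a < reverseOn A b ↔ b < a := by
  rw [reverseOn, Equiv.Perm.ofSubtype_apply_of_mem _ ha, Equiv.Perm.ofSubtype_apply_of_mem _ hb]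
  simp

theorem val_fl_of_lt (σ : Equiv.Perm (Fin n)) {i j : ℕ} (hj : 1 ≤ j) (hj' : j ≤ n) (hij : i < j) :
    val (fl i σ) j = val σ j := by
  rw [val_eq _ hj hj', val_eq _ hj hj', fl, Equiv.Perm.mul_apply, reverseOn_of_notMem]
  simp only [mem_image, mem_filter, mem_univ, true_and, not_exists, not_and]
  intro p hp h
  rw [σ.injective h] at hp
  simp only at hp
  omega

theorem val_fl_lt_iff (σ : Equiv.Perm (Fin n)) {i j k : ℕ} (hj : 1 ≤ j) (hj' : j ≤ n) (hij : j ≤ i)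
    (hk : 1 ≤ k) (hk' : k ≤ n) (hik : k ≤ i) :
    val (fl i σ) j < val (fl i σ) k ↔ val σ k < val σ j := by
  rw [val_eq _ hj hj', val_eq _ hj hj', val_eq _ hk hk', val_eq _ hk hk', fl,
    Equiv.Perm.mul_apply, Equiv.Perm.mul_apply, Nat.add_lt_add_iff_right, Nat.add_lt_add_iff_right,
    Fin.val_fin_lt, Fin.val_fin_lt, reverseOn_lt_iff]
  · exact mem_image_of_mem _ (mem_filter.2 ⟨mem_univ _, by simp only; omega⟩)
  · exact mem_image_of_mem _ (mem_filter.2 ⟨mem_univ _, by simp only; omega⟩)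

theorem exists_val_fl_eq (σ : Equiv.Perm (Fin n)) {i j : ℕ} (hj : 1 ≤ j) (hj' : j ≤ n)
    (hij : j ≤ i) : ∃ k, 1 ≤ k ∧ k ≤ i ∧ val (fl i σ) j = val σ k := by
  have h : fl i σ ⟨j - 1, by omega⟩ ∈ (univ.filter fun p : Fin n => (p : ℕ) < i).image σ := by
    rw [fl, Equiv.Perm.mul_apply]
    refine reverseOn_mem (mem_image_of_mem _ (mem_filter.2 ⟨mem_univ _, by simp only; omega⟩))
  obtain ⟨p, hp, hpe⟩ := mem_image.1 h
  have := (mem_filter.1 hp).2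
  refine ⟨p + 1, by omega, by omega, ?_⟩
  rw [val_fin, val_eq _ hj hj', hpe]

/-- All comparisons among the first `i` entries are reversed. -/
theorem code_fl_of_le (σ : Equiv.Perm (Fin n)) {i j : ℕ} (hj : 1 ≤ j) (hj' : j ≤ n) (hij : j ≤ i) :
    code (fl i σ) j = -code σ j := by
  rw [code, code, ← sum_neg_distrib]
  refine sum_congr rfl fun k hk => ?_
  obtain ⟨h1, h2⟩ := mem_Ico.1 hk
  rw [if_congr (val_fl_lt_iff σ h1 (by omega) (by omega) hj hj' hij) rfl rfl]
  have h3 : val σ k ≠ val σ j := fun h => by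
    have := val_inj σ h1 (by omega) hj hj' h; omega
  split_ifs <;> omega

/-- Given the entry in position `j`, the letter depends only on the set of preceding values, which
the flip preserves. -/
theorem code_fl_of_lt (σ : Equiv.Perm (Fin n)) {i j : ℕ} (hj : 1 ≤ j) (hj' : j ≤ n) (hij : i < j) :
    code (fl i σ) j = code σ j := by
  have hinj : ∀ τ : Equiv.Perm (Fin n), Set.InjOn (val τ) (Ico 1 j : Finset ℕ) :=
    fun τ a ha b hb hab => by
      have h1 := mem_Ico.1 (mem_coe.1 ha)
      have h2 := mem_Ico.1 (mem_coe.1 hb)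
      exact val_inj τ h1.1 (by omega) h2.1 (by omega) hab
  have himg : (Ico 1 j).image (val (fl i σ)) = (Ico 1 j).image (val σ) := by
    refine eq_of_subset_of_card_le (fun v hv => ?_) ?_
    · obtain ⟨k, hk, rfl⟩ := mem_image.1 hv
      obtain ⟨h1, h2⟩ := mem_Ico.1 hk
      rcases Nat.lt_or_ge i k with h | h
      · rw [val_fl_of_lt σ h1 (by omega) h]
        exact mem_image_of_mem _ hk
      · obtain ⟨l, h3, h4, h5⟩ := exists_val_fl_eq σ h1 (by omega) h
        rw [h5]
        exact mem_image_of_mem _ (mem_Ico.2 ⟨h3, by omega⟩)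
    · rw [card_image_of_injOn (hinj _), card_image_of_injOn (hinj _)]
  rw [code, code, val_fl_of_lt σ hj hj' hij,
    ← sum_image (f := fun v => if v < val σ j then (1 : ℤ) else -1) (hinj (fl i σ)), himg,
    sum_image (hinj σ)]

theorem exists_code_eq_mul (σ : Equiv.Perm (Fin n)) (d : ℕ → ℤ) (hd : ∀ j, d j = 1 ∨ d j = -1) :
    ∃ τ : Equiv.Perm (Fin n), ∀ j, 1 ≤ j → j ≤ n → code τ j = d j * code σ j := by
  have key : ∀ N, ∃ τ : Equiv.Perm (Fin n), ∀ j, 1 ≤ j → j ≤ n →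
      code τ j = if j ≤ N then d j * code σ j else code σ j := by
    intro N
    induction N with
    | zero => exact ⟨σ, fun j h _ => by rw [if_neg (by omega)]⟩
    | succ N ih =>
      obtain ⟨τ, hτ⟩ := ih
      rcases hd (N + 1) with h | h
      · refine ⟨τ, fun j h1 h2 => ?_⟩
        rw [hτ j h1 h2]
        rcases eq_or_ne j (N + 1) with rfl | hj
        · simp [h]
        · exact if_congr (by omega) rfl rfl
      -- The two flips together negate letter `N + 1` only.
      · refine ⟨fl (N + 1) (fl N τ), fun j h1 h2 => ?_⟩
        rcases lt_trichotomy j (N + 1) with hj | rfl | hj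
        · rw [code_fl_of_le _ h1 h2 hj.le, code_fl_of_le _ h1 h2 (by omega), hτ j h1 h2,
            if_pos (by omega), if_pos (by omega), neg_neg]
        · rw [code_fl_of_le _ h1 h2 le_rfl, code_fl_of_lt _ h1 h2 (by omega), hτ _ h1 h2,
            if_neg (by omega), if_pos le_rfl, h, neg_one_mul]
        · rw [code_fl_of_lt _ h1 h2 hj, code_fl_of_lt _ h1 h2 (by omega), hτ j h1 h2,
            if_neg (by omega), if_neg (by omega)]
  obtain ⟨τ, hτ⟩ := key n
  exact ⟨τ, fun j h1 h2 => by rw [hτ j h1 h2, if_pos h2]⟩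

theorem isSignClosed_code (n : ℕ) : IsSignClosed n (code (n := n)) where
  ext _ _ h := eq_of_code_eq h
  separated := absSeparated_code
  closed := exists_code_eq_mul

/-- Exchanging descents and ascents to the left of `t` toggles the spike at `t` only. -/
theorem mem_setSpike_of_toggle {D D' : Finset ℕ} {t : ℕ}
    (h : ∀ e, 1 ≤ e → e < n → (e ∈ D' ↔ ¬ (e ∈ D ↔ e < t))) {j : ℕ} (hj : 2 ≤ j) (hj' : j < n) :
    j ∈ setSpike n D' ↔ ¬ (j ∈ setSpike n D ↔ j = t) := by
  rw [mem_setSpike, mem_setSpike, h j (by omega) hj', h (j - 1) (by omega) (by omega)]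
  have h1 : j - 1 < t ↔ j < t ∨ j = t := by omega
  have h2 : j = t → ¬ j < t := by omega
  have h3 : 2 ≤ j ∧ j < n := ⟨hj, hj'⟩
  rw [h1]
  tauto

/-- Pairs left of `k` have both letters negated, pairs right of `k` neither. The pair `(k, k + 1)`
is toggled exactly if letter `k` dominates it, which decides the threshold. -/
theorem mem_des_fl (σ : Equiv.Perm (Fin n)) {k : ℕ} (hk : 1 ≤ k) (hk' : k < n) {e : ℕ}
    (he : 1 ≤ e) (he' : e < n) :
    e ∈ des (fl k σ) ↔
      ¬ (e ∈ des σ ↔ e < if |code σ (k + 1)| < |code σ k| then k + 1 else k) := by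
  rw [des_eq_descents_code, des_eq_descents_code, mem_descents, mem_descents,
    and_iff_right ⟨he, he'⟩, and_iff_right ⟨he, he'⟩]
  have hsep := absSeparated_code σ e he he'
  rcases lt_trichotomy e k with h | rfl | h
  · rw [code_fl_of_le σ he (by omega) h.le, code_fl_of_le σ (j := e + 1) (by omega) (by omega) h]
    have : code σ e ≠ code σ (e + 1) := fun h' => hsep (by rw [h'])
    split_ifs <;> omega
  · rw [code_fl_of_le σ he (by omega) le_rfl, code_fl_of_lt σ (by omega) (by omega) (by omega)]
    split_ifs with hc
    · rw [lt_iff_pos_of_abs_lt hc, lt_iff_pos_of_abs_lt (by rwa [abs_neg])]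
      have : code σ e ≠ 0 := fun h => by
        rw [h, abs_zero] at hc
        exact absurd hc (abs_nonneg _).not_gt
      omega
    · have hc' : |code σ e| < |code σ (e + 1)| := by omega
      rw [lt_iff_neg_of_abs_lt hc', lt_iff_neg_of_abs_lt (by rwa [abs_neg])]
      omega
  · rw [code_fl_of_lt σ he (by omega) h, code_fl_of_lt σ (by omega) (by omega) (by omega)]
    split_ifs <;> omega

theorem spike_fl_eq_sdiff_iff (σ : Equiv.Perm (Fin n)) {i k : ℕ} (hi : i ∈ spike σ) (hk : 1 ≤ k)
    (hk' : k < n) :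
    spike (fl k σ) = spike σ \ {i} ↔
      i = if |code σ (k + 1)| < |code σ k| then k + 1 else k := by
  have hmem := fun j => @mem_setSpike_of_toggle n _ _ _ (fun e => mem_des_fl σ hk hk') j
  simp only [← spike_eq_setSpike] at hmem
  have hrange : ∀ (τ : Equiv.Perm (Fin n)) j, j ∈ spike τ → 2 ≤ j ∧ j < n := fun τ j hj => by
    rw [spike_eq_setSpike] at hj
    exact (mem_setSpike.1 hj).1
  constructor
  · intro h
    by_contra hne
    have := (hmem i (hrange σ i hi).1 (hrange σ i hi).2).2 (by tauto)
    rw [h] at this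
    simp at this
  · intro h
    rw [← h] at hmem
    ext j
    rw [mem_sdiff, mem_singleton]
    by_cases hj : 2 ≤ j ∧ j < n
    · rw [hmem j hj.1 hj.2]
      by_cases hji : j = i
      · simp [hji, hi]
      · simp [hji]
    · exact iff_of_false (fun h => hj (hrange _ _ h)) fun h => hj (hrange _ _ h.1)

/-- With `x` the code, `fl i` toggles the spike at `i` exactly if `|x_i| < |x_{i+1}|`, and `fl (i -
1)` does so exactly if `|x_i| < |x_{i-1}|`. Both fail exactly at an absolute peak. -/
theorem admitsFlip_iff (σ : Equiv.Perm (Fin n)) (i : ℕ) :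
    AdmitsFlip σ i ↔ i ∈ spike σ ∧ i ∉ absPeaks n (code σ) := by
  rw [AdmitsFlip, AdmitsFlipPlus, AdmitsFlipMinus, ← and_or_left]
  refine and_congr_right fun hi => ?_
  have hr : 2 ≤ i ∧ i < n := by
    rw [spike_eq_setSpike] at hi
    exact (mem_setSpike.1 hi).1
  obtain ⟨j, rfl⟩ : ∃ j, i = j + 1 := ⟨i - 1, by omega⟩
  rw [spike_fl_eq_sdiff_iff σ hi (by omega) hr.2, Nat.add_sub_cancel,
    spike_fl_eq_sdiff_iff σ hi (by omega) (by omega), mem_absPeaks, and_iff_right hr,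
    Nat.add_sub_cancel]
  have h1 := absSeparated_code σ j (by omega) (by omega)
  have h2 := absSeparated_code σ (j + 1) (by omega) (by omega)
  split_ifs <;> omega

/-- Being in the descent class of `I` and admitting no flip, in terms of the code. -/
theorem mem_descentClass_and_no_flip_iff {I : Finset ℕ} (hI : I ⊆ Icc 2 (n - 1))
    (σ : Equiv.Perm (Fin n)) :
    (σ ∈ descentClass (spikeDescents I) n ∧ ∀ i, ¬ AdmitsFlip σ i) ↔
      descents n (code σ) = spikeDescents I ∧ absPeaks n (code σ) = I := by
  rw [descentClass, mem_filter, ← des_eq_descents_code, and_iff_right (mem_univ σ)]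
  refine and_congr_right fun h => ?_
  have hs : spike σ = I := by rw [spike_eq_setSpike, h, (spikeDescents_spec hI).2]
  have hsub : absPeaks n (code σ) ⊆ I := by
    rw [← hs, spike_eq_setSpike, des_eq_descents_code]
    exact absPeaks_subset_setSpike
  simp only [admitsFlip_iff, hs, not_and, not_not]
  exact ⟨fun h => hsub.antisymm h, fun h => h.ge⟩

end Flip

/-! ### Signed permutations and the comparison with codes. -/

section Signed

variable {n : ℕ}

/-- The value `a + 1`, negated if `a ∈ V`. -/
def signedVal (V : Finset (Fin n)) (a : Fin n) : ℤ :=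
  if a ∈ V then -((a : ℤ) + 1) else (a : ℤ) + 1

theorem abs_signedVal (V : Finset (Fin n)) (a : Fin n) : |signedVal V a| = (a : ℤ) + 1 := by
  have h : (0 : ℤ) ≤ (a : ℤ) + 1 := by omega
  unfold signedVal
  split_ifs
  · rw [abs_neg, abs_of_nonneg h]
  · exact abs_of_nonneg h

theorem signedVal_injective (V : Finset (Fin n)) : Function.Injective (signedVal V) := by
  intro a b h
  have := congrArg abs h
  rw [abs_signedVal, abs_signedVal] at this
  exact Fin.ext (by omega)

/-- The word of a signed permutation, given by a permutation and the set of its negated values. -/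
def signedWord (ω : Equiv.Perm (Fin n) × Finset (Fin n)) (j : ℕ) : ℤ :=
  if h : 1 ≤ j ∧ j ≤ n then signedVal ω.2 (ω.1 ⟨j - 1, by omega⟩) else 0

theorem signedWord_fin (ω : Equiv.Perm (Fin n) × Finset (Fin n)) (p : Fin n) :
    signedWord ω (p + 1) = signedVal ω.2 (ω.1 p) := dif_pos ⟨by omega, by omega⟩

theorem abs_signedWord (ω : Equiv.Perm (Fin n) × Finset (Fin n)) (j : ℕ) :
    |signedWord ω j| = |(val ω.1 j : ℤ)| := by
  rw [Nat.abs_cast]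
  unfold signedWord val
  split_ifs
  · rw [abs_signedVal]
    push_cast
    rfl
  · simp

theorem eq_of_signedWord_eq {ω ω' : Equiv.Perm (Fin n) × Finset (Fin n)}
    (h : ∀ j, 1 ≤ j → j ≤ n → signedWord ω j = signedWord ω' j) : ω = ω' := by
  have h1 : ∀ p, signedVal ω.2 (ω.1 p) = signedVal ω'.2 (ω'.1 p) := fun p => by
    rw [← signedWord_fin, ← signedWord_fin, h _ (by omega) (by omega)]
  have h2 : ω.1 = ω'.1 := by
    ext p
    have := congrArg abs (h1 p)
    rw [abs_signedVal, abs_signedVal] at this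
    omega
  refine Prod.ext h2 (Finset.ext fun a => ?_)
  have := h1 (ω.1.symm a)
  rw [← h2, Equiv.apply_symm_apply] at this
  unfold signedVal at this
  split_ifs at this with h3 h4 h4
  · exact iff_of_true h3 h4
  · omega
  · omega
  · exact iff_of_false h3 h4

theorem isSignClosed_signedWord (n : ℕ) : IsSignClosed n (signedWord (n := n)) where
  ext _ _ h := eq_of_signedWord_eq h
  separated ω i h1 h2 h := by
    rw [abs_signedWord, abs_signedWord, Nat.abs_cast, Nat.abs_cast, Nat.cast_inj] at h
    have := val_inj ω.1 h1 (by omega) (by omega) (by omega) h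
    omega
  closed ω d hd := by
    -- The sign of the value `a` is toggled when `d` is `-1` at the position of `a`.
    refine ⟨(ω.1, univ.filter fun a => ¬ (a ∈ ω.2 ↔ d (ω.1.symm a + 1) = -1)), fun j h1 h2 => ?_⟩
    obtain ⟨p, rfl⟩ : ∃ p : Fin n, j = p + 1 := ⟨⟨j - 1, by omega⟩, by simp; omega⟩
    rw [signedWord_fin, signedWord_fin]
    simp only [signedVal, mem_filter, mem_univ, true_and, Equiv.symm_apply_apply]
    rcases hd (p + 1) with h | h <;> rw [h] <;> by_cases hp : ω.1 p ∈ ω.2 <;> simp [hp]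

theorem descents_congr_of_lt_iff {x y : ℕ → ℤ}
    (h : ∀ i, 1 ≤ i → i < n → (x (i + 1) < x i ↔ y (i + 1) < y i)) :
    descents n x = descents n y := by
  ext i
  rw [mem_descents, mem_descents]
  exact and_congr_right fun hi => h i hi.1 hi.2

/-- For fixed `V` the signed values are linearly ordered, and sorting them relabels the values by a
permutation independent of `σ`. -/
theorem exists_descents_signedWord_eq (V : Finset (Fin n)) :
    ∃ ρ : Equiv.Perm (Fin n), ∀ σ, descents n (signedWord (σ, V)) = des (ρ * σ) := by
  have hs : StrictMono (signedVal V ∘ Tuple.sort (signedVal V)) :=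
    (Tuple.monotone_sort _).strictMono_of_injective
      ((signedVal_injective V).comp (Equiv.injective _))
  refine ⟨(Tuple.sort (signedVal V))⁻¹, fun σ => ?_⟩
  rw [des_eq_descents_val]
  refine descents_congr_of_lt_iff fun i h1 h2 => ?_
  have e := signedWord_fin (σ, V) ⟨i, h2⟩
  have e' := signedWord_fin (σ, V) ⟨i - 1, by omega⟩
  have f := val_fin ((Tuple.sort (signedVal V))⁻¹ * σ) ⟨i, h2⟩
  have f' := val_fin ((Tuple.sort (signedVal V))⁻¹ * σ) ⟨i - 1, by omega⟩
  simp only [Nat.sub_add_cancel h1] at e e' f f'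
  rw [e, e', f, f', Nat.cast_lt, Nat.add_lt_add_iff_right, Fin.val_fin_lt, ← hs.lt_iff_lt]
  simp

theorem card_descents_signedWord (S : Finset ℕ) :
    #{ω : Equiv.Perm (Fin n) × Finset (Fin n) | descents n (signedWord ω) = S} =
      2 ^ n * #(descentClass S n) := by
  rw [card_filter, Fintype.sum_prod_type_right]
  have : ∀ V : Finset (Fin n), ∑ σ : Equiv.Perm (Fin n),
      (if descents n (signedWord (σ, V)) = S then 1 else 0) = #(descentClass S n) := fun V => by
    obtain ⟨ρ, hρ⟩ := exists_descents_signedWord_eq V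
    simp only [hρ]
    rw [descentClass, card_filter]
    exact Equiv.sum_comp (Equiv.mulLeft ρ) fun σ => if des σ = S then 1 else 0
  simp only [this, sum_const, card_univ, Fintype.card_finset, Fintype.card_fin, smul_eq_mul]

theorem card_absPeaks_signedWord (J : Finset ℕ) :
    #{ω : Equiv.Perm (Fin n) × Finset (Fin n) | absPeaks n (signedWord ω) = J} =
      2 ^ n * #(peakClass J n) := by
  have h : ∀ ω : Equiv.Perm (Fin n) × Finset (Fin n), absPeaks n (signedWord ω) = peak ω.1 :=
    fun ω => by
      rw [peak_eq_absPeaks_val]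
      exact absPeaks_congr fun j _ _ => abs_signedWord ω j
  rw [card_filter, Fintype.sum_prod_type_right]
  have : ∀ V : Finset (Fin n), ∑ σ : Equiv.Perm (Fin n),
      (if absPeaks n (signedWord (σ, V)) = J then 1 else 0) = #(peakClass J n) := fun V => by
    simp only [h, peakClass, card_filter]
  simp only [this, sum_const, card_univ, Fintype.card_finset, Fintype.card_fin, smul_eq_mul]

/-- The number of permutations of `[n]` in the descent class of `I` that admit no flip, counted
through their codes. -/
def flipFreeCount (I : Finset ℕ) (n : ℕ) : ℕ :=
  #{σ : Equiv.Perm (Fin n) | descents n (code σ) = spikeDescents I ∧ absPeaks n (code σ) = I}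

/-- Both families satisfy `card_descents_eq_sum`, with left sides in ratio `2^n`; by induction the
terms of proper subsets of `I` cancel. -/
theorem two_pow_mul_flipFreeCount (I : Finset ℕ) (hI : I ⊆ Icc 2 (n - 1)) :
    2 ^ n * flipFreeCount I n =
      #{ω | descents n (signedWord (n := n) ω) = spikeDescents I ∧
        absPeaks n (signedWord ω) = I} := by
  induction I using Finset.strongInduction with
  | H I ih =>
    have h1 := card_descents_signedWord (n := n) (spikeDescents I)
    have h2 := (isSignClosed_code n).card_descents_eq_sum hI
    simp only [← des_eq_descents_code] at h2
    rw [(isSignClosed_signedWord n).card_descents_eq_sum hI, descentClass, h2, mul_sum,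
      ← add_sum_erase _ _ (mem_powerset_self I), ← add_sum_erase _ _ (mem_powerset_self I)] at h1
    simp only [des_eq_descents_code] at h1
    have h3 : ∀ J ∈ I.powerset.erase I, 2 ^ n * flipFreeCount J n =
        #{ω | descents n (signedWord (n := n) ω) = spikeDescents J ∧
          absPeaks n (signedWord ω) = J} := fun J hJ => by
      obtain ⟨h4, h5⟩ := mem_erase.1 hJ
      have h5 := mem_powerset.1 h5
      exact ih J (h5.ssubset_of_ne h4) (h5.trans hI)
    rw [← sum_congr rfl h3] at h1
    exact (Nat.add_right_cancel h1).symm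

theorem card_peakClass {I : Finset ℕ} (hI : IsAdmissible I) (hn : I ⊆ Icc 2 (n - 1)) :
    #(peakClass I n) = 2 ^ (n - 1 - #I) * flipFreeCount I n := by
  have h := (isSignClosed_signedWord n).card_absPeaks_eq hI hn
  rw [card_absPeaks_signedWord, ← two_pow_mul_flipFreeCount I hn, mul_left_comm] at h
  exact Nat.eq_of_mul_eq_mul_left (by positivity) h

theorem peakNumber_eq_flipFreeCount {I : Finset ℕ} (hI : IsAdmissible I) (hn : I.sup id < n) :
    peakNumber I n = flipFreeCount I n := by
  have hsub := subset_Icc_of_isAdmissible hI hn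
  have hc := card_le_card hsub
  rw [Nat.card_Icc] at hc
  rw [peakNumber, card_peakClass hI hsub, Nat.cast_mul, Nat.cast_pow, Nat.cast_ofNat, ← mul_assoc,
    ← zpow_natCast, ← zpow_add₀ two_ne_zero]
  have : -(n : ℤ) + #I + 1 + ((n - 1 - #I : ℕ) : ℤ) = 0 := by omega
  rw [this, zpow_zero, one_mul]

end Signed

/-! ### Permutations increasing after position `m`. -/

section Assemble

variable {m N : ℕ}

/-- The set of the first `m` values of a permutation of `[m + N]`. -/
def initSet (σ : Equiv.Perm (Fin (m + N))) : Finset (Fin (m + N)) :=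
  univ.image fun p : Fin m => σ (Fin.castAdd N p)

theorem card_initSet (σ : Equiv.Perm (Fin (m + N))) : #(initSet σ) = m := by
  have h : Function.Injective fun p : Fin m => σ (Fin.castAdd N p) :=
    σ.injective.comp (Fin.castAdd_injective m N)
  rw [initSet, card_image_of_injective _ h, card_univ, Fintype.card_fin]

theorem card_compl_of_card_eq {A : Finset (Fin (m + N))} (hA : #A = m) : #Aᶜ = N := by
  rw [card_compl, hA, Fintype.card_fin, Nat.add_sub_cancel_left]

/-- The permutation of `[m + N]` whose first `m` values are the elements of `A`, arranged in the
pattern `π`, and whose other values are increasing. -/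
def assemble (A : Finset (Fin (m + N))) (hA : #A = m) (π : Equiv.Perm (Fin m)) :
    Equiv.Perm (Fin (m + N)) :=
  finSumFinEquiv.symm.trans ((Equiv.sumCongr π (Equiv.refl _)).trans
    (finSumEquivOfFinset hA (card_compl_of_card_eq hA)))

variable {A : Finset (Fin (m + N))} (hA : #A = m)

theorem assemble_castAdd (π : Equiv.Perm (Fin m)) (p : Fin m) :
    assemble A hA π (Fin.castAdd N p) = A.orderEmbOfFin hA (π p) := by
  simp [assemble]

theorem assemble_natAdd (π : Equiv.Perm (Fin m)) (q : Fin N) :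
    assemble A hA π (Fin.natAdd m q) = Aᶜ.orderEmbOfFin (card_compl_of_card_eq hA) q := by
  simp [assemble]

theorem val_castAdd (σ : Equiv.Perm (Fin (m + N))) (p : Fin m) :
    val σ (p + 1) = (σ (Fin.castAdd N p) : ℕ) + 1 := val_fin σ (Fin.castAdd N p)

theorem val_natAdd (σ : Equiv.Perm (Fin (m + N))) (q : Fin N) :
    val σ (m + q + 1) = (σ (Fin.natAdd m q) : ℕ) + 1 := val_fin σ (Fin.natAdd m q)

theorem exists_fin_eq {j : ℕ} (h1 : 1 ≤ j) (h2 : j ≤ m) : ∃ p : Fin m, j = p + 1 :=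
  ⟨⟨j - 1, by omega⟩, by simp; omega⟩

theorem val_assemble_lt_iff (π : Equiv.Perm (Fin m)) {i j : ℕ} (hi : 1 ≤ i) (hi' : i ≤ m)
    (hj : 1 ≤ j) (hj' : j ≤ m) :
    val (assemble A hA π) i < val (assemble A hA π) j ↔ val π i < val π j := by
  obtain ⟨p, rfl⟩ := exists_fin_eq hi hi'
  obtain ⟨q, rfl⟩ := exists_fin_eq hj hj'
  rw [val_castAdd, val_castAdd, val_fin, val_fin, assemble_castAdd, assemble_castAdd,
    Nat.add_lt_add_iff_right, Nat.add_lt_add_iff_right, Fin.val_fin_lt, Fin.val_fin_lt,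
    OrderEmbedding.lt_iff_lt]

theorem code_assemble_of_le (π : Equiv.Perm (Fin m)) {j : ℕ} (hj : 1 ≤ j) (hj' : j ≤ m) :
    code (assemble A hA π) j = code π j := by
  refine sum_congr rfl fun i hi => ?_
  obtain ⟨h1, h2⟩ := mem_Ico.1 hi
  exact if_congr (val_assemble_lt_iff hA π h1 (by omega) hj hj') rfl rfl

theorem val_assemble_tail_lt (π : Equiv.Perm (Fin m)) {j : ℕ} (hj : m < j) (hj' : j < m + N) :
    val (assemble A hA π) j < val (assemble A hA π) (j + 1) := by
  have h1 := val_natAdd (assemble A hA π) ⟨j - m - 1, by omega⟩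
  have h2 := val_natAdd (assemble A hA π) ⟨j - m, by omega⟩
  rw [assemble_natAdd] at h1 h2
  simp only at h1 h2
  rw [show m + (j - m - 1) + 1 = j by omega] at h1
  rw [show m + (j - m) + 1 = j + 1 by omega] at h2
  rw [h1, h2, Nat.add_lt_add_iff_right, Fin.val_fin_lt, OrderEmbedding.lt_iff_lt, Fin.mk_lt_mk]
  omega

/-- The number of elements of `A` below all elements of the complement. -/
def lowGap {n : ℕ} (A : Finset (Fin n)) : ℕ := #{a ∈ A | ∀ b ∉ A, a < b}

theorem lowGap_eq_of_isLeast {n : ℕ} {A : Finset (Fin n)} {c : Fin n} (hc : c ∉ A)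
    (hmin : ∀ b ∉ A, c ≤ b) : lowGap A = #{a ∈ A | a < c} := by
  unfold lowGap
  congr 1
  refine filter_congr fun a _ => ⟨fun h => h c hc, fun h b hb => h.trans_le (hmin b hb)⟩

/-- The entry in position `m + 1` is the least value missing from `A`. -/
theorem code_assemble_succ (π : Equiv.Perm (Fin m)) (hN : 0 < N) :
    code (assemble A hA π) (m + 1) = 2 * lowGap A - m := by
  rw [code_eq_card _ (by omega)]
  have hq := val_natAdd (assemble A hA π) ⟨0, hN⟩
  rw [assemble_natAdd] at hq
  set c := Aᶜ.orderEmbOfFin (card_compl_of_card_eq hA) ⟨0, hN⟩ with hc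
  have hcA : c ∉ A := mem_compl.1 (orderEmbOfFin_mem _ _ _)
  have hmin : ∀ b ∉ A, c ≤ b := fun b hb => by
    have : b ∈ Set.range (Aᶜ.orderEmbOfFin (card_compl_of_card_eq hA)) := by
      rw [range_orderEmbOfFin]
      exact mem_coe.2 (mem_compl.2 hb)
    obtain ⟨q, rfl⟩ := this
    rw [hc, OrderEmbedding.le_iff_le]
    exact Fin.mk_le_of_le_val (Nat.zero_le _)
  simp only [add_zero] at hq
  have hcard : #{i ∈ Ico 1 (m + 1) | val (assemble A hA π) i < val (assemble A hA π) (m + 1)} =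
      lowGap A := by
    rw [lowGap_eq_of_isLeast hcA hmin]
    symm
    refine card_bij (fun a _ => ((assemble A hA π).symm a : ℕ) + 1) ?_ ?_ ?_
    · intro a ha
      obtain ⟨h1, h2⟩ := mem_filter.1 ha
      have : a ∈ Set.range (A.orderEmbOfFin hA) := by
        rw [range_orderEmbOfFin]; exact mem_coe.2 h1
      obtain ⟨r, hr⟩ := this
      have hr' : (assemble A hA π).symm a = Fin.castAdd N (π.symm r) := by
        rw [Equiv.symm_apply_eq, assemble_castAdd, Equiv.apply_symm_apply, hr]
      rw [mem_filter, mem_Ico, val_fin, hq, Equiv.apply_symm_apply, hr', Fin.val_castAdd]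
      have := (π.symm r).isLt
      have h2' : (a : ℕ) < c := h2
      omega
    · intro a _ b _ hab
      exact (assemble A hA π).symm.injective (Fin.ext (by omega))
    · intro i hi
      obtain ⟨h1, h2⟩ := mem_filter.1 hi
      obtain ⟨h3, h4⟩ := mem_Ico.1 h1
      obtain ⟨p, rfl⟩ := exists_fin_eq h3 (by omega : i ≤ m)
      rw [val_castAdd, hq, Nat.add_lt_add_iff_right, Fin.val_fin_lt] at h2
      refine ⟨assemble A hA π (Fin.castAdd N p), mem_filter.2 ⟨?_, h2⟩, by simp⟩
      rw [assemble_castAdd]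
      exact orderEmbOfFin_mem _ _ _
  rw [hcard]
  push_cast
  ring

theorem initSet_assemble (π : Equiv.Perm (Fin m)) : initSet (assemble A hA π) = A := by
  refine eq_of_subset_of_card_le (fun a ha => ?_) (by rw [card_initSet, hA])
  obtain ⟨p, _, rfl⟩ := mem_image.1 ha
  rw [assemble_castAdd]
  exact orderEmbOfFin_mem _ _ _

theorem assemble_injective : Function.Injective (assemble A hA) := by
  intro π π' h
  ext p
  have := congrArg (fun τ : Equiv.Perm (Fin (m + N)) => τ (Fin.castAdd N p)) h
  simp only [assemble_castAdd, EmbeddingLike.apply_eq_iff_eq] at this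
  rw [this]

theorem strictMono_tail {σ : Equiv.Perm (Fin (m + N))}
    (h : ∀ j, m < j → j < m + N → val σ j < val σ (j + 1)) :
    StrictMono fun q : Fin N => σ (Fin.natAdd m q) := by
  cases N with
  | zero => exact fun q => q.elim0
  | succ N =>
    refine Fin.strictMono_iff_lt_succ.2 fun q => ?_
    have h1 := val_natAdd σ q.castSucc
    have h2 := val_natAdd σ q.succ
    have h3 := h (m + q + 1) (by omega) (by omega)
    simp only [Fin.val_castSucc, Fin.val_succ] at h1 h2
    rw [← add_assoc m (q : ℕ) 1] at h2
    exact Fin.lt_def.2 (by omega)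

theorem exists_assemble_eq {σ : Equiv.Perm (Fin (m + N))} (hσ : initSet σ = A)
    (h : ∀ j, m < j → j < m + N → val σ j < val σ (j + 1)) : ∃ π, assemble A hA π = σ := by
  have hmem : ∀ p, σ (Fin.castAdd N p) ∈ A := fun p => hσ ▸ mem_image_of_mem _ (mem_univ p)
  have hinj : Function.Injective
      fun p : Fin m => (A.orderIsoOfFin hA).symm ⟨σ (Fin.castAdd N p), hmem p⟩ := by
    intro p q hpq
    simpa using hpq
  refine ⟨Equiv.ofBijective _ (Finite.injective_iff_bijective.1 hinj), Equiv.ext fun a => ?_⟩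
  refine Fin.addCases (fun p => ?_) (fun q => ?_) a
  · rw [assemble_castAdd, Equiv.ofBijective_apply, ← coe_orderIsoOfFin_apply,
      OrderIso.apply_symm_apply]
  · rw [assemble_natAdd]
    have hc : ∀ q, σ (Fin.natAdd m q) ∈ Aᶜ := fun q => by
      rw [mem_compl, ← hσ, initSet, mem_image]
      rintro ⟨p, _, hp⟩
      have := congrArg Fin.val (σ.injective hp)
      simp at this
      omega
    exact (congrFun (orderEmbOfFin_unique (card_compl_of_card_eq hA) hc (strictMono_tail h)) q).symm

end Assemble

/-! ### Reduction to the first `m + 1` letters of the code. -/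

section PrefixCount

variable {m N : ℕ}

/-- The word of length `m + 1` that extends the code of `π` by `2 t - m`. -/
def extCode (π : Equiv.Perm (Fin m)) (t j : ℕ) : ℤ := if j ≤ m then code π j else 2 * t - m

/-- The number of patterns of the first `m` values of flip-free permutations in the descent class
of `I` whose value in position `m + 1` exceeds exactly `t` of the preceding ones. -/
def prefixCount (I : Finset ℕ) (m t : ℕ) : ℕ :=
  #{π : Equiv.Perm (Fin m) | descents (m + 1) (extCode π t) = spikeDescents I ∧
    absPeaks (m + 1) (extCode π t) = I}

theorem abs_code_lt {n : ℕ} (σ : Equiv.Perm (Fin n)) {j : ℕ} (hj : 1 ≤ j) : |code σ j| < j := by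
  have h : #{i ∈ Ico 1 j | val σ i < val σ j} ≤ j - 1 :=
    (card_filter_le _ _).trans (by rw [Nat.card_Ico])
  rw [code_eq_card σ hj, abs_lt]
  omega

/-- With no missing value every element counts; this convention lets the case `N = 0` fit the
general formula. -/
theorem lowGap_univ (n : ℕ) : lowGap (univ : Finset (Fin n)) = n := by simp [lowGap]

theorem flipFree_assemble_iff {I : Finset ℕ} (hI : I ⊆ Icc 2 (m + N - 1)) (hm : I ⊆ Icc 2 m)
    {A : Finset (Fin (m + N))} (hA : #A = m) (π : Equiv.Perm (Fin m)) :
    (descents (m + N) (code (assemble A hA π)) = spikeDescents I ∧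
      absPeaks (m + N) (code (assemble A hA π)) = I) ↔
    (descents (m + 1) (extCode π (lowGap A)) = spikeDescents I ∧
      absPeaks (m + 1) (extCode π (lowGap A)) = I) := by
  set x := code (assemble A hA π) with hx
  set y := extCode π (lowGap A) with hy
  have hxy : ∀ j, 1 ≤ j → j ≤ m → x j = y j := fun j h1 h2 => by
    rw [hx, hy, extCode, if_pos h2, code_assemble_of_le hA π h1 h2]
  rcases Nat.eq_zero_or_pos N with rfl | hN
  · have hA' : A = univ := eq_univ_of_card A (by simpa using hA)
    -- For `N = 0` the letter in position `m + 1` is fictitious. Its value `m` exceeds `|y m|`, so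
    -- it creates neither a descent nor an absolute peak at `m`.
    have hlast : y (m + 1) = m := by
      rw [hy, extCode, if_neg (by omega), hA', lowGap_univ]
      push_cast
      ring
    have hm' : 1 ≤ m → |y m| < m := fun h => by
      rw [hy, extCode, if_pos le_rfl]
      exact abs_code_lt π h
    have hd : descents (m + 0) x = descents (m + 1) y := by
      ext e
      rw [mem_descents, mem_descents]
      rcases Nat.lt_or_ge e m with h | h
      · refine and_congr (by omega) ?_
        by_cases he : 1 ≤ e
        · rw [hxy e he (by omega), hxy (e + 1) (by omega) (by omega)]
        -- Position `0` precedes both words; the letter there is an empty sum.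
        · obtain rfl : e = 0 := by omega
          rw [hxy _ (by omega) (by omega), hx, hy]
          simp [code, extCode]
      · refine iff_of_false (by omega) fun h' => ?_
        obtain rfl : e = m := by omega
        have := abs_lt.1 (hm' (by omega))
        omega
    have hp : absPeaks (m + 0) x = absPeaks (m + 1) y := by
      ext i
      rw [mem_absPeaks, mem_absPeaks]
      constructor
      · rintro ⟨h1, h2⟩
        rw [hxy i (by omega) (by omega), hxy (i + 1) (by omega) (by omega),
          hxy (i - 1) (by omega) (by omega)] at h2
        exact ⟨by omega, h2⟩
      · rintro ⟨h1, h2⟩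
        have hne : i ≠ m := by
          rintro rfl
          have := hm' (by omega)
          rw [hlast, Nat.abs_cast] at h2
          omega
        rw [hxy i (by omega) (by omega), hxy (i + 1) (by omega) (by omega),
          hxy (i - 1) (by omega) (by omega)]
        exact ⟨by omega, h2⟩
    rw [hd, hp]
  · have hxy' : ∀ j, 1 ≤ j → j ≤ m + 1 → x j = y j := fun j h1 h2 => by
      rcases Nat.lt_or_ge m j with h | h
      · obtain rfl : j = m + 1 := by omega
        rw [hx, hy, extCode, if_neg (by omega), code_assemble_succ hA π hN]
      · exact hxy j h1 h
    have hd : descents (m + N) x = descents (m + 1) y := by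
      ext e
      rw [mem_descents, mem_descents]
      constructor
      · rintro ⟨h1, h2⟩
        have he : e ≤ m := by
          by_contra! hc
          have := val_assemble_tail_lt hA π hc h1.2
          rw [hx, code_succ_lt_iff _ h1.1 h1.2] at h2
          omega
        rw [hxy' e h1.1 (by omega), hxy' (e + 1) (by omega) (by omega)] at h2
        exact ⟨by omega, h2⟩
      · rintro ⟨h1, h2⟩
        rw [hxy' e h1.1 (by omega), hxy' (e + 1) (by omega) (by omega)]
        exact ⟨by omega, h2⟩
    rw [hd]
    refine and_congr_right fun hS => ?_
    -- Absolute peaks are spikes, and the descent set already confines spikes to `I`; no later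
    -- letter can matter.
    have hsub : absPeaks (m + N) x ⊆ Icc 2 m := by
      have := absPeaks_subset_setSpike (n := m + N) (x := x)
      rw [hd, hS, (spikeDescents_spec hI).2] at this
      exact this.trans hm
    suffices h : absPeaks (m + N) x = absPeaks (m + 1) y by rw [h]
    ext i
    constructor
    · intro hi
      have h3 := mem_Icc.1 (hsub hi)
      obtain ⟨h1, h2⟩ := mem_absPeaks.1 hi
      rw [hxy' i (by omega) (by omega), hxy' (i + 1) (by omega) (by omega),
        hxy' (i - 1) (by omega) (by omega)] at h2
      exact mem_absPeaks.2 ⟨by omega, h2⟩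
    · intro hi
      obtain ⟨h1, h2⟩ := mem_absPeaks.1 hi
      rw [← hxy' i (by omega) (by omega), ← hxy' (i + 1) (by omega) (by omega),
        ← hxy' (i - 1) (by omega) (by omega)] at h2
      exact mem_absPeaks.2 ⟨by omega, h2⟩

theorem card_flipFree_initSet {I : Finset ℕ} (hI : I ⊆ Icc 2 (m + N - 1)) (hm : I ⊆ Icc 2 m)
    {A : Finset (Fin (m + N))} (hA : #A = m) :
    #{σ : Equiv.Perm (Fin (m + N)) | (descents (m + N) (code σ) = spikeDescents I ∧
      absPeaks (m + N) (code σ) = I) ∧ initSet σ = A} = prefixCount I m (lowGap A) := by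
  symm
  refine card_bij (fun π _ => assemble A hA π) ?_ (fun _ _ _ _ h => assemble_injective hA h) ?_
  · intro π hπ
    rw [mem_filter] at hπ ⊢
    exact ⟨mem_univ _, (flipFree_assemble_iff hI hm hA π).2 hπ.2, initSet_assemble hA π⟩
  · intro σ hσ
    obtain ⟨_, hσ, hσA⟩ := mem_filter.1 hσ
    have htail : ∀ j, m < j → j < m + N → val σ j < val σ (j + 1) := fun j h1 h2 => by
      have hnot : j ∉ des σ := by
        rw [des_eq_descents_code, hσ.1, mem_spikeDescents]
        rintro ⟨_, h⟩
        obtain ⟨i, hi⟩ := card_pos.1 h.pos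
        obtain ⟨h3, h4⟩ := mem_filter.1 hi
        have := mem_Icc.1 (hm h3)
        omega
      rw [des_eq_descents_val, mem_descents, Nat.cast_lt] at hnot
      have hne : val σ j ≠ val σ (j + 1) := fun h => by
        have := val_inj σ (by omega) (by omega) (by omega) (by omega) h
        omega
      omega
    obtain ⟨π, rfl⟩ := exists_assemble_eq hA hσA htail
    exact ⟨π, mem_filter.2 ⟨mem_univ _, (flipFree_assemble_iff hI hm hA π).1 hσ⟩, rfl⟩

end PrefixCount

/-! ### Splitting the set of the first `m` values at `m`. -/

section Parts

variable {m N : ℕ}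

/-- The elements of `A` among the first `m` elements of `Fin (m + N)`. -/
def leftPart (A : Finset (Fin (m + N))) : Finset (Fin m) :=
  univ.filter fun p => Fin.castAdd N p ∈ A

/-- The elements of `A` among the last `N` elements of `Fin (m + N)`. -/
def rightPart (A : Finset (Fin (m + N))) : Finset (Fin N) :=
  univ.filter fun q => Fin.natAdd m q ∈ A

/-- The set with given left and right parts. -/
def joinParts (B : Finset (Fin m)) (C : Finset (Fin N)) : Finset (Fin (m + N)) :=
  B.image (Fin.castAdd N) ∪ C.image (Fin.natAdd m)

theorem mem_leftPart {A : Finset (Fin (m + N))} {p : Fin m} :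
    p ∈ leftPart A ↔ Fin.castAdd N p ∈ A := by simp [leftPart]

theorem mem_rightPart {A : Finset (Fin (m + N))} {q : Fin N} :
    q ∈ rightPart A ↔ Fin.natAdd m q ∈ A := by simp [rightPart]

theorem castAdd_ne_natAdd (p : Fin m) (q : Fin N) : Fin.castAdd N p ≠ Fin.natAdd m q := fun h => by
  have := congrArg Fin.val h
  simp at this
  omega

theorem castAdd_mem_joinParts {B : Finset (Fin m)} {C : Finset (Fin N)} {p : Fin m} :
    Fin.castAdd N p ∈ joinParts B C ↔ p ∈ B := by
  simp [joinParts, (castAdd_ne_natAdd _ _).symm]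

theorem natAdd_mem_joinParts {B : Finset (Fin m)} {C : Finset (Fin N)} {q : Fin N} :
    Fin.natAdd m q ∈ joinParts B C ↔ q ∈ C := by
  simp [joinParts, castAdd_ne_natAdd]

theorem parts_eq_iff {A : Finset (Fin (m + N))} {B : Finset (Fin m)} {C : Finset (Fin N)} :
    (leftPart A = B ∧ rightPart A = C) ↔ A = joinParts B C := by
  constructor
  · rintro ⟨rfl, rfl⟩
    ext a
    refine Fin.addCases (fun p => ?_) (fun q => ?_) a
    · rw [castAdd_mem_joinParts, mem_leftPart]
    · rw [natAdd_mem_joinParts, mem_rightPart]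
  · rintro rfl
    refine ⟨Finset.ext fun p => ?_, Finset.ext fun q => ?_⟩
    · rw [mem_leftPart, castAdd_mem_joinParts]
    · rw [mem_rightPart, natAdd_mem_joinParts]

theorem card_joinParts (B : Finset (Fin m)) (C : Finset (Fin N)) :
    #(joinParts B C) = #B + #C := by
  rw [joinParts, card_union_of_disjoint, card_image_of_injective _ (Fin.castAdd_injective m N),
    card_image_of_injective _ (Fin.natAdd_injective N m)]
  rw [disjoint_left]
  intro a ha hb
  obtain ⟨p, _, rfl⟩ := mem_image.1 ha
  obtain ⟨q, _, h⟩ := mem_image.1 hb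
  exact castAdd_ne_natAdd p q h.symm

/-- If `C` is nonempty, the size condition makes `B` omit some value, which lies below all of `C`,
so no element of `C` counts. Missing values above `m` do not constrain the elements of `B`. -/
theorem lowGap_joinParts {B : Finset (Fin m)} {C : Finset (Fin N)} (h : #B + #C = m) :
    lowGap (joinParts B C) = lowGap B := by
  have hlt : ∀ (p : Fin m) (q : Fin N), Fin.castAdd N p < Fin.natAdd m q := fun p q =>
    Fin.lt_def.2 (by simp; omega)
  unfold lowGap
  rw [← card_image_of_injective _ (Fin.castAdd_injective m N)]
  congr 1
  ext a
  refine Fin.addCases (fun p => ?_) (fun q => ?_) a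
  · rw [mem_filter, castAdd_mem_joinParts, (Fin.castAdd_injective m N).mem_finset_image, mem_filter]
    refine and_congr_right fun _ => ⟨fun hp b hb => ?_, fun hp b => ?_⟩
    · exact (Fin.strictMono_castAdd N).lt_iff_lt.1
        (hp (Fin.castAdd N b) (by rwa [castAdd_mem_joinParts]))
    · refine Fin.addCases (fun r hr => ?_) (fun r _ => hlt p r) b
      rw [castAdd_mem_joinParts] at hr
      exact Fin.strictMono_castAdd N (hp r hr)
  · refine iff_of_false (fun hq => ?_) fun hq => ?_
    · obtain ⟨h1, h2⟩ := mem_filter.1 hq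
      rw [natAdd_mem_joinParts] at h1
      have hB : B ≠ univ := by
        rintro rfl
        have := card_pos.2 ⟨q, h1⟩
        rw [card_univ, Fintype.card_fin] at h
        omega
      obtain ⟨b, hb⟩ : ∃ b, b ∉ B := by
        by_contra! hc
        exact hB (eq_univ_of_forall hc)
      exact lt_asymm (h2 (Fin.castAdd N b) (by rwa [castAdd_mem_joinParts])) (hlt b q)
    · obtain ⟨p, _, hp⟩ := mem_image.1 hq
      exact castAdd_ne_natAdd p q hp

/-- The number of flip-free permutations in the descent class of `I` that have `k` prescribed
values above `m` among the first `m` values. -/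
def binomialCoeff (I : Finset ℕ) (m k : ℕ) : ℕ :=
  ∑ B : Finset (Fin m) with #B + k = m, prefixCount I m (lowGap B)

theorem card_leftPart_add (σ : Equiv.Perm (Fin (m + N))) :
    #(leftPart (initSet σ)) + #(rightPart (initSet σ)) = m := by
  rw [← card_joinParts, ← parts_eq_iff.1 ⟨rfl, rfl⟩, card_initSet]

/-- The count depends on `C` only through its size, and not on `N`; this is the source of the
binomial coefficients. -/
theorem card_flipFree_rightPart {I : Finset ℕ} (hI : I ⊆ Icc 2 (m + N - 1)) (hm : I ⊆ Icc 2 m)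
    (C : Finset (Fin N)) :
    #{σ : Equiv.Perm (Fin (m + N)) | (descents (m + N) (code σ) = spikeDescents I ∧
      absPeaks (m + N) (code σ) = I) ∧ rightPart (initSet σ) = C} = binomialCoeff I m #C := by
  rw [binomialCoeff, card_eq_sum_card_fiberwise (f := fun σ => leftPart (initSet σ))
    (t := univ.filter fun B : Finset (Fin m) => #B + #C = m)]
  · refine sum_congr rfl fun B hB => ?_
    have hB := (mem_filter.1 hB).2
    rw [← lowGap_joinParts hB, ← card_flipFree_initSet hI hm ((card_joinParts B C).trans hB),
      filter_filter]
    congr 1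
    refine filter_congr fun σ _ => ?_
    rw [← parts_eq_iff, and_assoc, and_comm (a := leftPart _ = _)]
  · intro σ hσ
    have h1 := (mem_filter.1 (mem_coe.1 hσ)).2.2
    rw [mem_coe, mem_filter, ← h1]
    exact ⟨mem_univ _, card_leftPart_add σ⟩

theorem flipFreeCount_eq_sum {I : Finset ℕ} (hI : I ⊆ Icc 2 (m + N - 1)) (hm : I ⊆ Icc 2 m) :
    flipFreeCount I (m + N) = ∑ k ∈ range (m + 1), binomialCoeff I m k * N.choose k := by
  rw [flipFreeCount, card_eq_sum_card_fiberwise (f := fun σ => #(rightPart (initSet σ)))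
    (t := range (m + 1))]
  · refine sum_congr rfl fun k _ => ?_
    rw [card_eq_sum_card_fiberwise (f := fun σ => rightPart (initSet σ))
      (t := powersetCard k (univ : Finset (Fin N)))]
    · rw [sum_congr rfl (g := fun _ => binomialCoeff I m k), sum_const, card_powersetCard,
        card_univ, Fintype.card_fin, smul_eq_mul, mul_comm]
      intro C hC
      have hC := (mem_powersetCard.1 hC).2
      rw [filter_filter, filter_filter, ← hC, ← card_flipFree_rightPart hI hm]
      congr 1
      refine filter_congr fun σ _ => ?_
      refine and_congr_right fun _ => ⟨fun h => h.2, fun h => ⟨by rw [h], h⟩⟩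
    · intro σ hσ
      exact mem_coe.2 (mem_powersetCard.2 ⟨subset_univ _, (mem_filter.1 (mem_coe.1 hσ)).2⟩)
  · intro σ _
    have := card_leftPart_add σ
    exact mem_coe.2 (mem_range.2 (show #(rightPart (initSet σ)) < m + 1 by omega))

theorem init_inter_eq_iff (σ : Equiv.Perm (Fin (m + N))) {k : ℕ} (hk : k ≤ N) :
    init m σ ∩ Icc (m + 1) (m + N) = Icc (m + 1) (m + k) ↔
      rightPart (initSet σ) = univ.filter fun q : Fin N => (q : ℕ) < k := by
  have hmem : ∀ q : Fin N, m + q + 1 ∈ init m σ ↔ q ∈ rightPart (initSet σ) := fun q => by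
    rw [mem_rightPart, initSet, init, mem_image, mem_image]
    constructor
    · rintro ⟨i, hi, h⟩
      obtain ⟨h1, h2⟩ := mem_Icc.1 hi
      obtain ⟨p, rfl⟩ := exists_fin_eq h1 h2
      rw [val_castAdd] at h
      exact ⟨p, mem_univ _, Fin.ext (by simp; omega)⟩
    · rintro ⟨p, _, h⟩
      refine ⟨p + 1, mem_Icc.2 (by omega), ?_⟩
      rw [val_castAdd, h, Fin.val_natAdd]
  constructor
  · intro h
    ext q
    have := Finset.ext_iff.1 h (m + q + 1)
    rw [mem_inter, hmem, mem_Icc, mem_Icc] at this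
    rw [mem_filter, and_iff_right (mem_univ q)]
    have hq := q.isLt
    constructor
    · intro h1
      have := this.1 ⟨h1, by omega⟩
      omega
    · intro h1
      exact (this.2 (by omega)).1
  · intro h
    ext v
    rw [mem_inter, mem_Icc, mem_Icc]
    by_cases hv : m + 1 ≤ v ∧ v ≤ m + N
    · obtain ⟨q, rfl⟩ : ∃ q : Fin N, v = m + q + 1 := ⟨⟨v - m - 1, by omega⟩, by simp; omega⟩
      rw [hmem, h, mem_filter, and_iff_right (mem_univ q)]
      omega
    · omega

theorem card_flipFree_init {n : ℕ} (hn : n = m + N) {I : Finset ℕ} (hI : I ⊆ Icc 2 (n - 1))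
    (hm : I ⊆ Icc 2 m) {k : ℕ} (hk : k ≤ N) :
    #{σ : Equiv.Perm (Fin n) | (descents n (code σ) = spikeDescents I ∧
      absPeaks n (code σ) = I) ∧ init m σ ∩ Icc (m + 1) n = Icc (m + 1) (m + k)} =
      binomialCoeff I m k := by
  subst hn
  have hc : #(univ.filter fun q : Fin N => (q : ℕ) < k) = k := by
    rw [Fin.card_filter_val_lt, min_eq_right hk]
  simp only [init_inter_eq_iff _ hk]
  rw [card_flipFree_rightPart hI hm, hc]

/-- The choice `N = m` leaves room for `[m+1, m+k]` for every `k ≤ m`. -/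
theorem peakCoeff_eq_binomialCoeff {I : Finset ℕ} (hI : IsAdmissible I) (hm : I.sup id ≤ m) {k : ℕ}
    (hk : k ≤ m) : peakCoeff I m k = binomialCoeff I m k := by
  have hIm : I ⊆ Icc 2 m := by
    simpa using subset_Icc_of_isAdmissible hI (Nat.lt_succ_of_le hm)
  have hI2 : I ⊆ Icc 2 (2 * m - 1) := fun i hi => by
    have := mem_Icc.1 (hIm hi)
    exact mem_Icc.2 (by omega)
  rw [← card_flipFree_init (two_mul m) hI2 hIm hk, peakCoeff]
  congr 1
  ext σ
  simp only [mem_filter, ← mem_descentClass_and_no_flip_iff hI2 σ]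
  constructor
  · rintro ⟨h1, h2, h3⟩
    exact ⟨mem_univ _, ⟨h1, h3⟩, h2⟩
  · rintro ⟨_, ⟨h1, h3⟩, h2⟩
    exact ⟨h1, h2, h3⟩

theorem peakNumber_eq_sum_of_le {I : Finset ℕ} (hI : IsAdmissible I) (hm : I.sup id ≤ m) {n : ℕ}
    (hn : I.sup id < n) (hmn : m ≤ n) :
    peakNumber I n = ∑ k ∈ range (m + 1), (peakCoeff I m k : ℚ) * Ring.choose ((n : ℚ) - m) k := by
  have hIm : I ⊆ Icc 2 m := by
    simpa using subset_Icc_of_isAdmissible hI (Nat.lt_succ_of_le hm)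
  rw [peakNumber_eq_flipFreeCount hI hn]
  have hsub := subset_Icc_of_isAdmissible hI hn
  obtain ⟨N, rfl⟩ := Nat.exists_eq_add_of_le hmn
  rw [flipFreeCount_eq_sum hsub hIm, Nat.cast_sum]
  refine sum_congr rfl fun k hk => ?_
  rw [peakCoeff_eq_binomialCoeff hI hm (Nat.lt_succ_iff.1 (mem_range.1 hk)), Nat.cast_add,
    add_sub_cancel_left, Ring.choose_natCast, Nat.cast_mul]

end Parts

/-! ### Polynomial identities in the binomial basis. -/

section Polynomial

open Polynomial

/-- Every value of a combination of the binomial coefficients `x ↦ binom(x - m, k)` is a value of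
one polynomial. -/
theorem exists_polynomial_eval_eq (m : ℕ) (s : Finset ℕ) (c : ℕ → ℚ) :
    ∃ P : ℚ[X], ∀ x : ℚ, P.eval x = ∑ k ∈ s, c k * Ring.choose (x - m) k := by
  refine ⟨∑ k ∈ s, C (c k) * (C ((k.factorial : ℚ)⁻¹) *
    ((descPochhammer ℤ k).map (algebraMap ℤ ℚ)).comp (X - C (m : ℚ))), fun x => ?_⟩
  rw [eval_finsetSum]
  refine sum_congr rfl fun k _ => ?_
  rw [eval_mul, eval_mul, eval_C, eval_C, eval_comp, eval_sub, eval_X, eval_C,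
    Ring.choose_eq_smul, eval_map_algebraMap, aeval_eq_smeval, smul_eq_mul]

theorem sum_choose_eq_of_eventually_eq {m m' L : ℕ} {c c' : ℕ → ℚ}
    (h : ∀ n : ℕ, L ≤ n → ∑ k ∈ range (m + 1), c k * Ring.choose ((n : ℚ) - m) k =
      ∑ k ∈ range (m' + 1), c' k * Ring.choose ((n : ℚ) - m') k) (x : ℚ) :
    ∑ k ∈ range (m + 1), c k * Ring.choose (x - m) k =
      ∑ k ∈ range (m' + 1), c' k * Ring.choose (x - m') k := by
  obtain ⟨P, hP⟩ := exists_polynomial_eval_eq m (range (m + 1)) c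
  obtain ⟨Q, hQ⟩ := exists_polynomial_eval_eq m' (range (m' + 1)) c'
  have hPQ : P = Q := by
    refine eq_of_infinite_eval_eq P Q (Set.Infinite.mono ?_
      ((Set.Ici_infinite L).image (Nat.cast_injective (R := ℚ)).injOn))
    rintro _ ⟨n, hn, rfl⟩
    rw [Set.mem_ofPred_eq, hP, hQ, h n hn]
  rw [← hP, ← hQ, hPQ]

/-- At `x = m + j` the basis takes the values `binom(j,k)`, a unitriangular system. -/
theorem coeff_eq_of_forall_sum_eq {m : ℕ} {c c' : ℕ → ℚ}
    (h : ∀ x : ℚ, ∑ k ∈ range (m + 1), c k * Ring.choose (x - m) k =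
      ∑ k ∈ range (m + 1), c' k * Ring.choose (x - m) k) : ∀ k ≤ m, c k = c' k := by
  intro j
  induction j using Nat.strong_induction_on with
  | _ j ih =>
    intro hj
    have h1 := h ((m + j : ℕ) : ℚ)
    simp only [Nat.cast_add, add_sub_cancel_left, Ring.choose_natCast] at h1
    have hmem : j ∈ range (m + 1) := mem_range.2 (by omega)
    rw [← add_sum_erase _ _ hmem, ← add_sum_erase _ _ hmem, Nat.choose_self, Nat.cast_one, mul_one,
      mul_one, sum_congr rfl (g := fun k => c' k * (j.choose k : ℚ))] at h1
    · exact add_right_cancel h1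
    · intro k hk
      obtain ⟨h2, h3⟩ := mem_erase.1 hk
      rcases lt_or_gt_of_ne h2 with h4 | h4
      · rw [ih k h4 (by omega)]
      · rw [Nat.choose_eq_zero_of_lt h4, Nat.cast_zero, mul_zero, mul_zero]

end Polynomial

end PeakPoly

/-! ### The expansion and its uniqueness. -/

theorem mainTheorem1 (I : Finset ℕ) (m : ℕ) (hI : PeakPoly.IsAdmissible I)
    (hm : I.sup id ≤ m) :
    (∀ n : ℕ, I.sup id < n →
      PeakPoly.peakNumber I n =
        ∑ k ∈ Finset.range (m + 1),
          (PeakPoly.peakCoeff I m k : ℚ) * Ring.choose ((n : ℚ) - (m : ℚ)) k) ∧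
    (∀ c : ℕ → ℚ,
      (∀ n : ℕ, I.sup id < n →
        PeakPoly.peakNumber I n =
          ∑ k ∈ Finset.range (m + 1), c k * Ring.choose ((n : ℚ) - (m : ℚ)) k) →
      ∀ k ≤ m, c k = (PeakPoly.peakCoeff I m k : ℚ) ∧ 0 ≤ c k) := by
  have hexp : ∀ n : ℕ, I.sup id < n →
      PeakPoly.peakNumber I n =
        ∑ k ∈ Finset.range (m + 1),
          (PeakPoly.peakCoeff I m k : ℚ) * Ring.choose ((n : ℚ) - (m : ℚ)) k := by
    intro n hn
    -- The count centred at `m` needs `m ≤ n`, whereas the centre `max(I)` covers every `n >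
    -- max(I)`. Both expansions give `p(I,j)` for `j ≥ m + 1`, so they agree as polynomials, also at
    -- `n < m`.
    rw [PeakPoly.peakNumber_eq_sum_of_le hI le_rfl hn hn.le]
    refine PeakPoly.sum_choose_eq_of_eventually_eq (L := m + 1) (fun j hj => ?_) _
    rw [← PeakPoly.peakNumber_eq_sum_of_le hI le_rfl (by omega) (by omega),
      ← PeakPoly.peakNumber_eq_sum_of_le hI hm (by omega) (by omega)]
  refine ⟨hexp, fun c hc k hk => ?_⟩
  have hck : c k = (PeakPoly.peakCoeff I m k : ℚ) := by
    refine PeakPoly.coeff_eq_of_forall_sum_eq (c' := fun k => (PeakPoly.peakCoeff I m k : ℚ))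
      (PeakPoly.sum_choose_eq_of_eventually_eq (L := I.sup id + 1) fun n hn => ?_) k hk
    rw [← hc n (by omega), ← hexp n (by omega)]
  exact ⟨hck, hck ▸ Nat.cast_nonneg _⟩
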